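/- Let $A\in\mathbb R^{n\times n}$, $B\in\mathbb R^{n\times l}$, $E\in\mathbb R^{n\times m}$, $z\in\mathbb R^n$ with $(A,B)$ stabilizable, and put $f(x,u,w)=Ax+Bu+Ew+z$. Let $Q_1,Q_2\in\mathbb R^{n\times n}$ and $R_1,R_2\in\mathbb R^{l\times l}$ be symmetric with $Q_1,Q_2,R_2\ge 0$ and $R_1>0$, and let $s\in\mathbb R^n$, $v\in\mathbb R^l$, $c\in\mathbb R$. Let $(\Omega,\mathcal F,\mathbb P)$ be a probability space carrying an i.i.d. sequence $(W(k))_{k\in\mathbb N_0}$ in $L^2(\Omega;\mathbb R^m)$ with law $\varrho_W$ and mean $\mu_W$. For $X\in L^2(\Omega;\mathbb R^n)$ and $U\in L^2(\Omega;\mathbb R^l)$ define the stage cost $$\ell(X,U)=\mathbb E\big[X^TQ_1X+U^TR_1U+s^TX+v^TU+c\big]+\mathrm{Tr}\big(Q_2\,\mathrm{Cov}(X)\big)+\mathrm{Tr}\big(R_2\,\mathrm{Cov}(U)\big),$$ and for constants $x\in\mathbb R^n$, $u\in\mathbb R^l$ let $\ell(x,u)=x^TQ_1x+u^TR_1u+s^Tx+v^Tu+c$.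 Let $\mathcal P_2(\mathbb R^n)$ be the set of probability measures on $\mathbb R^n$ with finite second moment, and let $\mathbb F(\mathbb R^n,\mathbb R^l)$ be the set of measurable maps $\pi:\mathbb R^n\to\mathbb R^l$ such that $\pi\circ X\in L^2(\Omega;\mathbb R^l)$ for every $X\in L^2(\Omega;\mathbb R^n)$. Assume that the steady-state equation $(I-A)x-Bu=E\mu_W+z$ has a solution $(x,u)$ and that $(A,Q_1^{1/2})$ is detectable. Then the following hold. (a) The algebraic Riccati equation $$P=A^TPA+(Q_1+Q_2)-A^TPB\,[(R_1+R_2)+B^TPB]^{-1}B^TPA$$ has exactly one positive semidefinite solution $P$, and among all solutions $(x,u)$ of the steady-state equation there is exactly one, $(x^\star,u^\star)$, that minimizes $\ell(x,u)$. Set $K=-[(R_1+R_2)+B^TPB]^{-1}B^TPA$ and $\pi^\star(x)=K(x-x^\star)+u^\star$. (b) Call a pair $(\varrho,\pi)$, with $\varrho$ a measure on $\mathbb R^n$ and $\pi\in\mathbb F(\mathbb R^n,\mathbb R^l)$, feasible if there are independent $X\in L^2(\Omega;\mathbb R^n)$ and $W\in L^2(\Omega;\mathbb R^m)$ with $X\sim\varrho$,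 $W\sim\varrho_W$ and $f(X,\pi(X),W)\sim\varrho$. Then there is a distribution $\varrho_X^{s,\star}\in\mathcal P_2(\mathbb R^n)$ such that $(\varrho,\pi^\star)$ is feasible if and only if $\varrho=\varrho_X^{s,\star}$; that is, $\varrho_X^{s,\star}$ is the stationary distribution of the system under the feedback $\pi^\star$. (c) The pair $(\varrho_X^{s,\star},\pi^\star)$ is a solution of the stationary optimization problem of minimizing $\ell(X,\pi\circ X)$, $X\sim\varrho$, over all feasible pairs $(\varrho,\pi)$. (d) Every solution $(\bar\varrho,\bar\pi)$ of this problem satisfies $\bar\varrho=\varrho_X^{s,\star}$. -/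

import Mathlib

open MeasureTheory ProbabilityTheory Matrix
open scoped ENNReal MatrixOrder

noncomputable section

/-! Vectors are elements of `Fin n → ℝ`. Norms enter only through square integrability, which does
not depend on the choice of a norm on a finite-dimensional space. -/

namespace StochLQ

/-- A real square matrix is Schur stable if all its complex eigenvalues lie in the open unit
disc. -/
def SchurStable {n : ℕ} (M : Matrix (Fin n) (Fin n) ℝ) : Prop :=
  ∀ c ∈ spectrum ℂ (M.map (algebraMap ℝ ℂ)), ‖c‖ < 1

/-- `(A, B)` is stabilizable. -/
def Stabilizable {n l : ℕ} (A : Matrix (Fin n) (Fin n) ℝ) (B : Matrix (Fin n) (Fin l) ℝ) : Prop :=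
  ∃ F : Matrix (Fin l) (Fin n) ℝ, SchurStable (A + B * F)

/-- `(A, C)` is detectable. -/
def Detectable {n p : ℕ} (A : Matrix (Fin n) (Fin n) ℝ) (C : Matrix (Fin p) (Fin n) ℝ) : Prop :=
  ∃ L : Matrix (Fin n) (Fin p) ℝ, SchurStable (A + L * C)

/-- The data of the linear system `X⁺ = A X + B U + E W + z` and of the stage cost. -/
structure Data (n l m : ℕ) where
  A : Matrix (Fin n) (Fin n) ℝ
  B : Matrix (Fin n) (Fin l) ℝ
  E : Matrix (Fin n) (Fin m) ℝ
  z : Fin n → ℝ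
  Q₁ : Matrix (Fin n) (Fin n) ℝ
  Q₂ : Matrix (Fin n) (Fin n) ℝ
  R₁ : Matrix (Fin l) (Fin l) ℝ
  R₂ : Matrix (Fin l) (Fin l) ℝ
  s : Fin n → ℝ
  v : Fin l → ℝ
  c : ℝ
  stabilizable : Stabilizable A B
  posSemidef_Q₁ : Q₁.PosSemidef
  posSemidef_Q₂ : Q₂.PosSemidef
  posDef_R₁ : R₁.PosDef
  posSemidef_R₂ : R₂.PosSemidef

/-- The covariance matrix of a random vector. -/
def covMat {Ω : Type*} [MeasurableSpace Ω] (μ : Measure Ω) {d : ℕ} (X : Ω → Fin d → ℝ) :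
    Matrix (Fin d) (Fin d) ℝ :=
  Matrix.of fun i j => cov[fun ω => X ω i, fun ω => X ω j; μ]

/-- `ϱ` is a probability measure with finite second moment. -/
def MemP2 {d : ℕ} (ϱ : Measure (Fin d → ℝ)) : Prop :=
  IsProbabilityMeasure ϱ ∧ ∫⁻ x, ‖x‖ₑ ^ 2 ∂ϱ < ∞

/-- The class of measurable feedbacks `π` with `π ∘ X ∈ L²` for each `X ∈ L²`. -/
def IsFeedback {Ω : Type*} [MeasurableSpace Ω] (μ : Measure Ω) {n l : ℕ}
    (π : (Fin n → ℝ) → (Fin l → ℝ)) : Prop :=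
  Measurable π ∧ ∀ X : Ω → Fin n → ℝ, MemLp X 2 μ → MemLp (π ∘ X) 2 μ

namespace Data

variable {n l m : ℕ} (D : Data n l m)

/-- The dynamics `f(x, u, w) = A x + B u + E w + z`. -/
def f (x : Fin n → ℝ) (u : Fin l → ℝ) (w : Fin m → ℝ) : Fin n → ℝ :=
  D.A *ᵥ x + D.B *ᵥ u + D.E *ᵥ w + D.z

/-- The deterministic stage cost `xᵀ Q₁ x + uᵀ R₁ u + sᵀ x + vᵀ u + c`. -/
def detCost (x : Fin n → ℝ) (u : Fin l → ℝ) : ℝ :=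
  x ⬝ᵥ D.Q₁ *ᵥ x + u ⬝ᵥ D.R₁ *ᵥ u + D.s ⬝ᵥ x + D.v ⬝ᵥ u + D.c

/-- The stochastic stage cost
`𝔼[Xᵀ Q₁ X + Uᵀ R₁ U + sᵀ X + vᵀ U + c] + Tr (Q₂ Cov(X)) + Tr (R₂ Cov(U))`. -/
def stageCost {Ω : Type*} [MeasurableSpace Ω] (μ : Measure Ω)
    (X : Ω → Fin n → ℝ) (U : Ω → Fin l → ℝ) : ℝ :=
  (∫ ω, (X ω ⬝ᵥ D.Q₁ *ᵥ X ω + U ω ⬝ᵥ D.R₁ *ᵥ U ω + D.s ⬝ᵥ X ω + D.v ⬝ᵥ U ω + D.c) ∂μ)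
    + ((D.Q₂ * covMat μ X).trace + (D.R₂ * covMat μ U).trace)

/-- `(x, u)` is a steady state of the deterministic system whose noise is frozen at its mean
`w`. -/
def IsSteadyState (w : Fin m → ℝ) (x : Fin n → ℝ) (u : Fin l → ℝ) : Prop :=
  (1 - D.A) *ᵥ x - D.B *ᵥ u = D.E *ᵥ w + D.z

/-- `(x, u)` minimizes the deterministic stage cost over all steady states. -/
def IsOptimalSteadyState (w : Fin m → ℝ) (x : Fin n → ℝ) (u : Fin l → ℝ) : Prop :=
  D.IsSteadyState w x u ∧ ∀ x' u', D.IsSteadyState w x' u' → D.detCost x u ≤ D.detCost x' u'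

/-- `P` is a positive semidefinite solution of the discrete-time algebraic Riccati equation with
weights `Q₁ + Q₂` and `R₁ + R₂`. -/
def IsRiccatiSolution (P : Matrix (Fin n) (Fin n) ℝ) : Prop :=
  P.PosSemidef ∧
    P = D.Aᵀ * P * D.A + (D.Q₁ + D.Q₂)
      - D.Aᵀ * P * D.B * ((D.R₁ + D.R₂) + D.Bᵀ * P * D.B)⁻¹ * D.Bᵀ * P * D.A

/-- The gain `K = -[(R₁ + R₂) + Bᵀ P B]⁻¹ Bᵀ P A`. -/
def gain (P : Matrix (Fin n) (Fin n) ℝ) : Matrix (Fin l) (Fin n) ℝ :=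
  -(((D.R₁ + D.R₂) + D.Bᵀ * P * D.B)⁻¹ * D.Bᵀ * P * D.A)

/-- The feedback `x ↦ K (x - x⋆) + u⋆`. -/
def optFeedback (P : Matrix (Fin n) (Fin n) ℝ) (xs : Fin n → ℝ) (us : Fin l → ℝ) :
    (Fin n → ℝ) → (Fin l → ℝ) :=
  fun x => D.gain P *ᵥ (x - xs) + us

variable {Ω : Type*} [MeasurableSpace Ω] (μ : Measure Ω) (ϱW : Measure (Fin m → ℝ))

/-- The constraints of the stationary optimization problem for the decision `(ϱ, π)`, with
witnesses `X` and `V` (the noise). -/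
structure IsWitness (ϱ : Measure (Fin n → ℝ)) (π : (Fin n → ℝ) → (Fin l → ℝ))
    (X : Ω → Fin n → ℝ) (V : Ω → Fin m → ℝ) : Prop where
  feedback : IsFeedback μ π
  memLp_state : MemLp X 2 μ
  memLp_noise : MemLp V 2 μ
  law_state : μ.map X = ϱ
  law_noise : μ.map V = ϱW
  indep : IndepFun X V μ
  law_next : μ.map (fun ω => D.f (X ω) (π (X ω)) (V ω)) = ϱ

/-- `(ϱ, π)` is feasible: `ϱ` is invariant under the feedback `π`. -/
def IsFeasible (ϱ : Measure (Fin n → ℝ)) (π : (Fin n → ℝ) → (Fin l → ℝ)) : Prop :=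
  ∃ X V, D.IsWitness μ ϱW ϱ π X V

/-- `(ϱ, π)` solves the stationary optimization problem: it is feasible, and its stage cost
`ℓ(X, π ∘ X)` is minimal among all feasible pairs. -/
def IsSolution (ϱ : Measure (Fin n → ℝ)) (π : (Fin n → ℝ) → (Fin l → ℝ)) : Prop :=
  D.IsFeasible μ ϱW ϱ π ∧
    ∀ X V, D.IsWitness μ ϱW ϱ π X V →
      ∀ ϱ' π' X' V', D.IsWitness μ ϱW ϱ' π' X' V' →
        D.stageCost μ X (π ∘ X) ≤ D.stageCost μ X' (π' ∘ X')

end Data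

end StochLQ

end

/-! Let `P` solve the Riccati equation, let `K` be its gain and `S = R₁ + R₂ + BᵀPB`. Take a
feasible pair with state `X`, input `U = π(X)` and means `x`, `u`. Stationarity makes `(x, u)` a
steady state. Complete the square in the Riccati equation for the centered variables and integrate:
the next state has the law of `X` and the noise is independent of `X`, so the `P`-terms collapse to
a pure noise term. With `Z = U - u - K(X - x)` this gives (`IsWitness.stageCost_eq`) cost = `ℓ(x,
u)` + 𝔼[(E(W - μ_W))ᵀ P E(W - μ_W)] + 𝔼[Zᵀ S Z]. The second term is the same for all feasible pairs,
the first is smallest only at the optimal steady state, and the third is nonnegative and vanishes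
only if `Z = 0` almost surely. The optimal feedback attains both minima. Conversely, a minimizer
agrees almost surely with the optimal feedback along its own state, so its law is stationary for
that feedback, and there is only one such law.

Three ingredients support this. The Riccati solution is the limit of value iteration from zero,
bounded through stabilizability; detectability makes every positive semidefinite solution
stabilizing, and two stabilizing solutions dominate each other (`existsUnique_riccati`). The
deterministic cost is strictly convex along the directions that preserve steadiness
(`existsUnique_isOptimalSteadyState`). The closed loop is a stable affine recursion: a series in the
i.i.d. noise gives a stationary law (`exists_stationary`), and characteristic functions give
uniqueness (`eq_of_charFunDual_eq_comp_mul`). -/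

open Filter Topology

namespace StochLQ

/-! ### Schur stability: geometric decay and a criterion over the reals. -/

section Gelfand

attribute [local instance] Matrix.linftyOpNormedRing Matrix.linftyOpNormedAlgebra

/-- Powers of a complex matrix with spectral radius below one decay geometrically. -/
theorem exists_norm_pow_le_of_spectrum {n : ℕ} (M : Matrix (Fin n) (Fin n) ℂ)
    (hM : ∀ c ∈ spectrum ℂ M, ‖c‖ < 1) :
    ∃ C r : ℝ, 0 < C ∧ 0 < r ∧ r < 1 ∧ ∀ k, ‖M ^ k‖ ≤ C * r ^ k := by
  have hρ : spectralRadius ℂ M < (1 : NNReal) := by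
    -- The spectrum is empty when `n = 0`.
    rcases (spectrum ℂ M).eq_empty_or_nonempty with h | h
    · simp [spectralRadius, h]
    · exact spectrum.spectralRadius_lt_of_forall_lt_of_nonempty h
        fun c hc => by simpa [← NNReal.coe_lt_coe] using hM c hc
  obtain ⟨r, hr, hr1⟩ := ENNReal.lt_iff_exists_nnreal_btwn.1 hρ
  have hr0 : 0 < r := by
    rcases eq_or_lt_of_le (zero_le (a := r)) with h | h
    · subst h; simp at hr
    · exact h
  have hr1' : (r : ℝ) < 1 := by exact_mod_cast hr1
  have hev : ∀ᶠ k : ℕ in atTop, ‖M ^ k‖ ≤ 1 * ‖(r : ℝ) ^ k‖ := by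
    have := (spectrum.pow_nnnorm_pow_one_div_tendsto_nhds_spectralRadius M).eventually_lt_const hr
    filter_upwards [this, eventually_gt_atTop 0] with k hk hk0
    have hk0' : (0 : ℝ) < k := by exact_mod_cast hk0
    have h1 : ((‖M ^ k‖₊ : ℝ≥0∞)) ≤ (r : ℝ≥0∞) ^ (k : ℝ) := by
      calc ((‖M ^ k‖₊ : ℝ≥0∞)) = ((‖M ^ k‖₊ : ℝ≥0∞) ^ (1 / k : ℝ)) ^ (k : ℝ) := by
            rw [← ENNReal.rpow_mul, one_div_mul_cancel hk0'.ne', ENNReal.rpow_one]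
        _ ≤ _ := ENNReal.rpow_le_rpow hk.le hk0'.le
    rw [ENNReal.rpow_natCast] at h1
    have h2 : ‖M ^ k‖₊ ≤ r ^ k := by exact_mod_cast h1
    have h3 : ‖M ^ k‖ ≤ (r : ℝ) ^ k := by exact_mod_cast h2
    simpa using h3
  -- Enlarging the constant absorbs the finitely many initial powers; this needs `r ^ k ≠ 0`, hence
  -- `0 < r`.
  obtain ⟨C, hC, hb⟩ := Asymptotics.bound_of_isBigO_nat_atTop (Asymptotics.IsBigO.of_bound 1 hev)
  refine ⟨C, r, hC, by exact_mod_cast hr0, hr1', fun k => ?_⟩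
  have hk := hb (x := k) (by positivity)
  simpa using hk

/-- The trajectories of a Schur stable matrix decay geometrically. -/
theorem SchurStable.exists_norm_le {n : ℕ} {M : Matrix (Fin n) (Fin n) ℝ} (hM : SchurStable M) :
    ∃ C r : ℝ, 0 < C ∧ 0 < r ∧ r < 1 ∧ ∀ k (x : Fin n → ℝ), ‖(M ^ k) *ᵥ x‖ ≤ C * r ^ k * ‖x‖ := by
  obtain ⟨C, r, hC, hr, hr1, h⟩ := exists_norm_pow_le_of_spectrum _ hM
  refine ⟨C, r, hC, hr, hr1, fun k x => ?_⟩
  have hnorm : ∀ y : Fin n → ℝ, ‖fun i => (y i : ℂ)‖ = ‖y‖ := fun y => by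
    simp [Pi.norm_def]
  have hpow : (M.map (algebraMap ℝ ℂ)) ^ k = (M ^ k).map (algebraMap ℝ ℂ) := by
    rw [← RingHom.mapMatrix_apply, ← RingHom.mapMatrix_apply, map_pow]
  have hmv : ((M.map (algebraMap ℝ ℂ)) ^ k) *ᵥ (fun i => (x i : ℂ))
      = fun i => (((M ^ k) *ᵥ x) i : ℂ) := by
    rw [hpow]; ext i
    simp [mulVec, dotProduct]
  rw [← hnorm, ← hmv, ← hnorm x]
  exact (linfty_opNorm_mulVec _ _).trans (by gcongr; exact h k)

end Gelfand

theorem SchurStable.tendsto_pow_mulVec {n : ℕ} {M : Matrix (Fin n) (Fin n) ℝ}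
    (hM : SchurStable M) (x : Fin n → ℝ) : Tendsto (fun k => (M ^ k) *ᵥ x) atTop (𝓝 0) := by
  obtain ⟨C, r, hC, hr, hr1, h⟩ := hM.exists_norm_le
  refine squeeze_zero_norm (fun k => h k x) ?_
  have := ((tendsto_pow_atTop_nhds_zero_of_lt_one hr.le hr1).const_mul C).mul_const ‖x‖
  simpa using this

theorem SchurStable.eq_zero_of_mulVec_eq {n : ℕ} {M : Matrix (Fin n) (Fin n) ℝ}
    (hM : SchurStable M) {x : Fin n → ℝ} (hx : M *ᵥ x = x) : x = 0 := by
  have hk : ∀ k : ℕ, (M ^ k) *ᵥ x = x := fun k => by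
    induction k with
    | zero => simp
    | succ k ih => rw [pow_succ, ← mulVec_mulVec, hx, ih]
  have := hM.tendsto_pow_mulVec x
  simp only [hk] at this
  exact tendsto_nhds_unique tendsto_const_nhds this

/-- A real description of Schur stability: no invariant pair `(a, b) ≠ 0` on which the matrix acts
as multiplication by a complex number of modulus at least one. -/
theorem schurStable_of_real {n : ℕ} {M : Matrix (Fin n) (Fin n) ℝ}
    (h : ∀ (α β : ℝ) (a b : Fin n → ℝ), 1 ≤ α ^ 2 + β ^ 2 → M *ᵥ a = α • a - β • b →
      M *ᵥ b = β • a + α • b → a = 0 ∧ b = 0) : SchurStable M := by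
  intro c hc
  by_contra hlt
  have hc1 : 1 ≤ ‖c‖ := not_lt.1 hlt
  obtain ⟨v, hv⟩ := (Module.End.hasEigenvalue_iff_mem_spectrum.2
    (by rwa [Matrix.spectrum_toLin']) : Module.End.HasEigenvalue
      (Matrix.toLin' (M.map (algebraMap ℝ ℂ))) c).exists_hasEigenvector
  have hv1 := hv.apply_eq_smul
  have hcomp : ∀ i, ∑ j, (M i j : ℂ) * v j = c * v i := fun i => by
    simpa [mulVec, dotProduct] using congrFun hv1 i
  have := h c.re c.im (fun i => (v i).re) (fun i => (v i).im) ?_ ?_ ?_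
  · refine hv.2 (funext fun i => Complex.ext ?_ ?_)
    · exact congrFun this.1 i
    · exact congrFun this.2 i
  · have : (1 : ℝ) ≤ ‖c‖ ^ 2 := by nlinarith
    rw [Complex.sq_norm, Complex.normSq_apply] at this
    nlinarith
  · ext i
    simpa [mulVec, dotProduct] using congrArg Complex.re (hcomp i)
  · ext i
    have := congrArg Complex.im (hcomp i)
    simp [mulVec, dotProduct] at this ⊢
    linarith

/-- The real form of the eigenvector condition for a Schur stable matrix. -/
theorem SchurStable.eq_zero_of_real {n : ℕ} {M : Matrix (Fin n) (Fin n) ℝ} (hM : SchurStable M)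
    {α β : ℝ} {a b : Fin n → ℝ} (hαβ : 1 ≤ α ^ 2 + β ^ 2) (ha : M *ᵥ a = α • a - β • b)
    (hb : M *ᵥ b = β • a + α • b) : a = 0 ∧ b = 0 := by
  by_contra hne
  let v : Fin n → ℂ := fun i => ⟨a i, b i⟩
  have hv : v ≠ 0 := fun h0 => hne ⟨funext fun i => congrArg Complex.re (congrFun h0 i),
    funext fun i => congrArg Complex.im (congrFun h0 i)⟩
  have hmv : Matrix.toLin' (M.map (algebraMap ℝ ℂ)) v = (⟨α, β⟩ : ℂ) • v := by
    ext i
    have h1 := congrFun ha i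
    have h2 := congrFun hb i
    apply Complex.ext
    · simpa [mulVec, dotProduct, v] using h1
    · simp [mulVec, dotProduct, v] at h2 ⊢
      linarith
  have hspec : (⟨α, β⟩ : ℂ) ∈ spectrum ℂ (M.map (algebraMap ℝ ℂ)) := by
    rw [← Matrix.spectrum_toLin']
    exact (Module.End.hasEigenvalue_of_hasEigenvector
      ⟨Module.End.mem_eigenspace_iff.2 hmv, hv⟩).mem_spectrum
  have := hM _ hspec
  have h2 : ‖(⟨α, β⟩ : ℂ)‖ ^ 2 = α ^ 2 + β ^ 2 := by
    rw [Complex.sq_norm, Complex.normSq_mk]; ring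
  nlinarith [norm_nonneg (⟨α, β⟩ : ℂ)]


/-! ### Quadratic forms of symmetric matrices. -/

section Quadratic

variable {n l : ℕ}

theorem dotProduct_transpose_mulVec (M : Matrix (Fin n) (Fin l) ℝ) (x : Fin l → ℝ)
    (y : Fin n → ℝ) : x ⬝ᵥ Mᵀ *ᵥ y = (M *ᵥ x) ⬝ᵥ y := by
  rw [dotProduct_mulVec, vecMul_transpose]

theorem dotProduct_mulVec_comm {M : Matrix (Fin n) (Fin n) ℝ} (hM : M.IsHermitian)
    (x y : Fin n → ℝ) : x ⬝ᵥ M *ᵥ y = y ⬝ᵥ M *ᵥ x := by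
  have h : Mᵀ = M := by simpa [IsHermitian, conjTranspose_eq_transpose_of_trivial] using hM
  rw [← h, dotProduct_transpose_mulVec, h, dotProduct_comm]

theorem quad_nonneg_of_posSemidef {M : Matrix (Fin n) (Fin n) ℝ} (hM : M.PosSemidef)
    (x : Fin n → ℝ) : 0 ≤ x ⬝ᵥ M *ᵥ x := by
  simpa using hM.dotProduct_mulVec_nonneg x

theorem eq_zero_of_quad_of_posDef {M : Matrix (Fin n) (Fin n) ℝ} (hM : M.PosDef)
    {x : Fin n → ℝ} (h : x ⬝ᵥ M *ᵥ x ≤ 0) : x = 0 := by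
  by_contra hx
  have := hM.dotProduct_mulVec_pos hx
  simp only [star_trivial] at this
  linarith

theorem quad_add {M : Matrix (Fin n) (Fin n) ℝ} (hM : M.IsHermitian) (x y : Fin n → ℝ) :
    (x + y) ⬝ᵥ M *ᵥ (x + y) = x ⬝ᵥ M *ᵥ x + 2 * (x ⬝ᵥ M *ᵥ y) + y ⬝ᵥ M *ᵥ y := by
  rw [mulVec_add, dotProduct_add, add_dotProduct, add_dotProduct, dotProduct_mulVec_comm hM y x]
  ring

theorem quad_sub {M : Matrix (Fin n) (Fin n) ℝ} (hM : M.IsHermitian) (x y : Fin n → ℝ) :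
    (x - y) ⬝ᵥ M *ᵥ (x - y) = x ⬝ᵥ M *ᵥ x - 2 * (x ⬝ᵥ M *ᵥ y) + y ⬝ᵥ M *ᵥ y := by
  rw [mulVec_sub, dotProduct_sub, sub_dotProduct, sub_dotProduct, dotProduct_mulVec_comm hM y x]
  ring

/-- Polarization. It transfers equality and convergence from quadratic forms to matrix entries. -/
theorem entry_eq_quad {M : Matrix (Fin n) (Fin n) ℝ} (hM : M.IsHermitian) (i j : Fin n) :
    M i j = ((Pi.single i 1 + Pi.single j 1) ⬝ᵥ M *ᵥ (Pi.single i 1 + Pi.single j 1)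
      - Pi.single i 1 ⬝ᵥ M *ᵥ Pi.single i 1 - Pi.single j 1 ⬝ᵥ M *ᵥ Pi.single j 1) / 2 := by
  rw [quad_add hM]
  simp only [mulVec_single_one, single_one_dotProduct, col_apply]
  ring

theorem eq_of_quad_eq {M N : Matrix (Fin n) (Fin n) ℝ} (hM : M.IsHermitian) (hN : N.IsHermitian)
    (h : ∀ x, x ⬝ᵥ M *ᵥ x = x ⬝ᵥ N *ᵥ x) : M = N := by
  ext i j
  rw [entry_eq_quad hM, entry_eq_quad hN, h, h, h]

/-- The kernel of the square root of a positive semidefinite matrix. -/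
theorem sqrt_mulVec_eq_zero {M : Matrix (Fin n) (Fin n) ℝ} (hM : M.PosSemidef)
    {x : Fin n → ℝ} (h : x ⬝ᵥ M *ᵥ x ≤ 0) : CFC.sqrt M *ᵥ x = 0 := by
  have hsq : CFC.sqrt M * CFC.sqrt M = M := CFC.sqrt_mul_sqrt_self M hM.nonneg
  have hherm : (CFC.sqrt M).IsHermitian := (Matrix.nonneg_iff_posSemidef.1 (CFC.sqrt_nonneg M)).1
  have ht : (CFC.sqrt M)ᵀ = CFC.sqrt M := by
    simpa [IsHermitian, conjTranspose_eq_transpose_of_trivial] using hherm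
  have h1 : (CFC.sqrt M *ᵥ x) ⬝ᵥ (CFC.sqrt M *ᵥ x) = x ⬝ᵥ M *ᵥ x := by
    rw [← dotProduct_transpose_mulVec, ht, mulVec_mulVec, hsq]
  have h2 : 0 ≤ (CFC.sqrt M *ᵥ x) ⬝ᵥ (CFC.sqrt M *ᵥ x) :=
    Finset.sum_nonneg fun i _ => mul_self_nonneg _
  exact dotProduct_self_eq_zero.1 (le_antisymm (h1 ▸ h) h2)

end Quadratic

/-! ### The algebraic Riccati equation. -/

section Riccati

variable {n l : ℕ} (A : Matrix (Fin n) (Fin n) ℝ) (B : Matrix (Fin n) (Fin l) ℝ)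
  (Q : Matrix (Fin n) (Fin n) ℝ) (R : Matrix (Fin l) (Fin l) ℝ)

/-- The Riccati operator. -/
noncomputable def riccati (P : Matrix (Fin n) (Fin n) ℝ) : Matrix (Fin n) (Fin n) ℝ :=
  Aᵀ * P * A + Q - Aᵀ * P * B * (R + Bᵀ * P * B)⁻¹ * Bᵀ * P * A

/-- The gain belonging to `P`. -/
noncomputable def riccatiGain (P : Matrix (Fin n) (Fin n) ℝ) : Matrix (Fin l) (Fin n) ℝ :=
  -((R + Bᵀ * P * B)⁻¹ * Bᵀ * P * A)

variable {A B Q R}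

theorem posDef_weight {P : Matrix (Fin n) (Fin n) ℝ} (hR : R.PosDef) (hP : P.PosSemidef) :
    (R + Bᵀ * P * B).PosDef := by
  have := hP.conjTranspose_mul_mul_same B
  rw [conjTranspose_eq_transpose_of_trivial] at this
  exact hR.add_posSemidef this

theorem quad_congr (P : Matrix (Fin n) (Fin n) ℝ) (M : Matrix (Fin n) (Fin l) ℝ)
    (x : Fin l → ℝ) : x ⬝ᵥ (Mᵀ * P * M) *ᵥ x = (M *ᵥ x) ⬝ᵥ P *ᵥ (M *ᵥ x) := by
  rw [Matrix.mul_assoc, ← mulVec_mulVec, dotProduct_transpose_mulVec, ← mulVec_mulVec]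

/-- Completion of the square for the Riccati operator. -/
theorem riccati_complete_square {P : Matrix (Fin n) (Fin n) ℝ} (hR : R.PosDef)
    (hP : P.PosSemidef) (x : Fin n → ℝ) (u : Fin l → ℝ) :
    x ⬝ᵥ Q *ᵥ x + u ⬝ᵥ R *ᵥ u + (A *ᵥ x + B *ᵥ u) ⬝ᵥ P *ᵥ (A *ᵥ x + B *ᵥ u)
      = x ⬝ᵥ riccati A B Q R P *ᵥ x
        + (u - riccatiGain A B R P *ᵥ x) ⬝ᵥ (R + Bᵀ * P * B) *ᵥ
            (u - riccatiGain A B R P *ᵥ x) := by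
  have hS := posDef_weight (B := B) hR hP
  have hSK : (R + Bᵀ * P * B) * riccatiGain A B R P = -(Bᵀ * P * A) := by
    rw [riccatiGain, Matrix.mul_neg, Matrix.mul_assoc _ Bᵀ, Matrix.mul_assoc _ (Bᵀ * P),
      Matrix.mul_nonsing_inv_cancel_left _ _ hS.det_pos.ne'.isUnit]
  have hric : riccati A B Q R P = Aᵀ * P * A + Q + Aᵀ * P * B * riccatiGain A B R P := by
    rw [riccati, riccatiGain, Matrix.mul_neg, sub_eq_add_neg]
    simp only [Matrix.mul_assoc]
  set k := riccatiGain A B R P *ᵥ x with hk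
  have hSk : (R + Bᵀ * P * B) *ᵥ k = -(Bᵀ *ᵥ (P *ᵥ (A *ᵥ x))) := by
    rw [hk, mulVec_mulVec, hSK, neg_mulVec, ← mulVec_mulVec, ← mulVec_mulVec]
  rw [quad_sub hS.1, quad_add hP.1, hSk, dotProduct_neg, dotProduct_neg,
    dotProduct_transpose_mulVec, dotProduct_transpose_mulVec, hric]
  simp only [add_mulVec, dotProduct_add, quad_congr]
  rw [← mulVec_mulVec, ← hk, ← mulVec_mulVec, ← mulVec_mulVec, dotProduct_transpose_mulVec,
    dotProduct_mulVec_comm hP.1 (A *ᵥ x) (B *ᵥ u), dotProduct_mulVec_comm hP.1 (A *ᵥ x) (B *ᵥ k)]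
  ring

/-- The choice of input that annihilates the completed square. Together with `quad_riccati_le` it
shows that the Riccati operator minimizes the one-step cost with terminal weight `P` over all
inputs. -/
theorem quad_riccati_eq {P : Matrix (Fin n) (Fin n) ℝ} (hR : R.PosDef)
    (hP : P.PosSemidef) (x : Fin n → ℝ) :
    x ⬝ᵥ riccati A B Q R P *ᵥ x = x ⬝ᵥ Q *ᵥ x
      + (riccatiGain A B R P *ᵥ x) ⬝ᵥ R *ᵥ (riccatiGain A B R P *ᵥ x)
      + ((A + B * riccatiGain A B R P) *ᵥ x) ⬝ᵥ P *ᵥ ((A + B * riccatiGain A B R P) *ᵥ x) := by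
  have h := riccati_complete_square (A := A) (B := B) (Q := Q) hR hP x (riccatiGain A B R P *ᵥ x)
  rw [sub_self, zero_dotProduct, add_zero] at h
  rw [← h, add_mulVec, ← mulVec_mulVec x B]

theorem quad_riccati_le {P : Matrix (Fin n) (Fin n) ℝ} (hR : R.PosDef)
    (hP : P.PosSemidef) (x : Fin n → ℝ) (u : Fin l → ℝ) :
    x ⬝ᵥ riccati A B Q R P *ᵥ x
      ≤ x ⬝ᵥ Q *ᵥ x + u ⬝ᵥ R *ᵥ u + (A *ᵥ x + B *ᵥ u) ⬝ᵥ P *ᵥ (A *ᵥ x + B *ᵥ u) := by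
  rw [riccati_complete_square hR hP]
  exact le_add_of_nonneg_right (quad_nonneg_of_posSemidef (posDef_weight hR hP).posSemidef _)

theorem isHermitian_riccati {P : Matrix (Fin n) (Fin n) ℝ} (hQ : Q.PosSemidef) (hR : R.PosDef)
    (hP : P.PosSemidef) : (riccati A B Q R P).IsHermitian := by
  have hS := (posDef_weight (B := B) hR hP).1.inv
  simp only [IsHermitian, conjTranspose_eq_transpose_of_trivial] at hS
  have hPt : Pᵀ = P := by simpa [conjTranspose_eq_transpose_of_trivial] using hP.1.eq
  have hQt : Qᵀ = Q := by simpa [conjTranspose_eq_transpose_of_trivial] using hQ.1.eq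
  simp only [IsHermitian, conjTranspose_eq_transpose_of_trivial, riccati, transpose_sub,
    transpose_add, transpose_mul, transpose_transpose, hPt, hQt, hS]
  simp only [Matrix.mul_assoc]

theorem posSemidef_riccati {P : Matrix (Fin n) (Fin n) ℝ} (hQ : Q.PosSemidef) (hR : R.PosDef)
    (hP : P.PosSemidef) : (riccati A B Q R P).PosSemidef := by
  refine PosSemidef.of_dotProduct_mulVec_nonneg (isHermitian_riccati hQ hR hP) fun x => ?_
  rw [star_trivial, quad_riccati_eq hR hP]
  have h1 := quad_nonneg_of_posSemidef hQ x
  have h2 := quad_nonneg_of_posSemidef hR.posSemidef (riccatiGain A B R P *ᵥ x)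
  have h3 := quad_nonneg_of_posSemidef hP ((A + B * riccatiGain A B R P) *ᵥ x)
  linarith

/-- The input that is optimal for `P'` is admissible for `P`, where it costs no more. -/
theorem riccati_mono {P P' : Matrix (Fin n) (Fin n) ℝ} (hR : R.PosDef) (hP : P.PosSemidef)
    (hP' : P'.PosSemidef) (h : ∀ x, x ⬝ᵥ P *ᵥ x ≤ x ⬝ᵥ P' *ᵥ x) (x : Fin n → ℝ) :
    x ⬝ᵥ riccati A B Q R P *ᵥ x ≤ x ⬝ᵥ riccati A B Q R P' *ᵥ x := by
  have h1 := quad_riccati_le (A := A) (B := B) (Q := Q) hR hP x (riccatiGain A B R P' *ᵥ x)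
  rw [quad_riccati_eq hR hP', add_mulVec, ← mulVec_mulVec]
  have h2 := h (A *ᵥ x + B *ᵥ riccatiGain A B R P' *ᵥ x)
  linarith

/-- A positive semidefinite solution of the Riccati equation is stabilizing. -/
theorem schurStable_of_riccati {P Q₁ : Matrix (Fin n) (Fin n) ℝ} (hR : R.PosDef)
    (hP : P.PosSemidef) (hric : riccati A B Q R P = P) (hQ₁ : Q₁.PosSemidef)
    (hle : ∀ x, x ⬝ᵥ Q₁ *ᵥ x ≤ x ⬝ᵥ Q *ᵥ x) (hdet : Detectable A (CFC.sqrt Q₁)) :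
    SchurStable (A + B * riccatiGain A B R P) := by
  obtain ⟨L, hL⟩ := hdet
  refine schurStable_of_real fun α β a b hαβ ha hb => ?_
  have ea := quad_riccati_eq (A := A) (B := B) (Q := Q) hR hP a
  have eb := quad_riccati_eq (A := A) (B := B) (Q := Q) hR hP b
  rw [hric, ha, quad_sub hP.1] at ea
  rw [hric, hb, quad_add hP.1] at eb
  simp only [mulVec_smul, dotProduct_smul, smul_dotProduct, smul_eq_mul] at ea eb
  rw [dotProduct_mulVec_comm hP.1 a b] at ea eb
  have pa := quad_nonneg_of_posSemidef hP a
  have pb := quad_nonneg_of_posSemidef hP b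
  have qa := quad_nonneg_of_posSemidef hQ₁ a
  have qb := quad_nonneg_of_posSemidef hQ₁ b
  have la := hle a
  have lb := hle b
  have ka := quad_nonneg_of_posSemidef hR.posSemidef (riccatiGain A B R P *ᵥ a)
  have kb := quad_nonneg_of_posSemidef hR.posSemidef (riccatiGain A B R P *ᵥ b)
  -- In the sum of `ea` and `eb` the mixed terms cancel and the `P`-terms of the image are `α ^ 2 +
  -- β ^ 2` times the original ones. So the running costs add up to minus the quantity below, and
  -- each of them must vanish.
  have key : 0 ≤ (α ^ 2 + β ^ 2 - 1) * (a ⬝ᵥ P *ᵥ a + b ⬝ᵥ P *ᵥ b) :=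
    mul_nonneg (by linarith) (by linarith)
  have ka0 : riccatiGain A B R P *ᵥ a = 0 := eq_zero_of_quad_of_posDef hR (by nlinarith)
  have kb0 : riccatiGain A B R P *ᵥ b = 0 := eq_zero_of_quad_of_posDef hR (by nlinarith)
  have ca0 : CFC.sqrt Q₁ *ᵥ a = 0 := sqrt_mulVec_eq_zero hQ₁ (by nlinarith)
  have cb0 : CFC.sqrt Q₁ *ᵥ b = 0 := sqrt_mulVec_eq_zero hQ₁ (by nlinarith)
  -- On `a` and `b` both the gain and `CFC.sqrt Q₁` vanish, so `A + BK` and the stable matrix `A + L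
  -- * CFC.sqrt Q₁` both act as `A`.
  refine hL.eq_zero_of_real hαβ ?_ ?_
  · rw [← ha, add_mulVec, add_mulVec, ← mulVec_mulVec, ← mulVec_mulVec, ca0, ka0]; simp
  · rw [← hb, add_mulVec, add_mulVec, ← mulVec_mulVec, ← mulVec_mulVec, cb0, kb0]; simp

theorem continuous_quad (M : Matrix (Fin n) (Fin n) ℝ) :
    Continuous fun x : Fin n → ℝ => x ⬝ᵥ M *ᵥ x := by
  simp only [dotProduct, mulVec]; fun_prop

/-- Comparison of a solution of the Riccati equation with a stabilizing one. -/
theorem quad_le_of_schurStable {P P' : Matrix (Fin n) (Fin n) ℝ} (hR : R.PosDef)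
    (hP : P.PosSemidef) (hP' : P'.PosSemidef) (hric : riccati A B Q R P = P)
    (hric' : riccati A B Q R P' = P') (hst : SchurStable (A + B * riccatiGain A B R P'))
    (x : Fin n → ℝ) : x ⬝ᵥ P *ᵥ x ≤ x ⬝ᵥ P' *ᵥ x := by
  set M := A + B * riccatiGain A B R P' with hM
  set d : (Fin n → ℝ) → ℝ := fun y => y ⬝ᵥ P' *ᵥ y - y ⬝ᵥ P *ᵥ y with hd
  -- The gain of `P'` is optimal for `P'` but only admissible for `P`, so `d` cannot grow along the
  -- closed loop of `P'`; it tends to zero there, hence `0 ≤ d x`.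
  have hstep : ∀ y, d (M *ᵥ y) ≤ d y := fun y => by
    have h1 := quad_riccati_le (A := A) (B := B) (Q := Q) hR hP y (riccatiGain A B R P' *ᵥ y)
    have h2 := quad_riccati_eq (A := A) (B := B) (Q := Q) hR hP' y
    rw [hric] at h1
    rw [hric'] at h2
    have h3 : A *ᵥ y + B *ᵥ riccatiGain A B R P' *ᵥ y = M *ᵥ y := by
      rw [hM, add_mulVec, mulVec_mulVec]
    rw [h3] at h1
    rw [← hM] at h2
    simp only [hd]
    linarith
  have hk : ∀ k : ℕ, d ((M ^ k) *ᵥ x) ≤ d x := fun k => by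
    induction k with
    | zero => simp
    | succ k ih =>
      rw [pow_succ', ← mulVec_mulVec]
      exact (hstep _).trans ih
  have hcont : Continuous d := (continuous_quad P').sub (continuous_quad P)
  have hlim := (hcont.tendsto 0).comp (hst.tendsto_pow_mulVec x)
  have h0 : d 0 = 0 := by simp [hd]
  have := le_of_tendsto' hlim hk
  rw [h0] at this
  simp only [hd] at this
  linarith

/-- The iterates of the Riccati operator, started at zero. -/
noncomputable def riccatiIter (A : Matrix (Fin n) (Fin n) ℝ) (B : Matrix (Fin n) (Fin l) ℝ)
    (Q : Matrix (Fin n) (Fin n) ℝ) (R : Matrix (Fin l) (Fin l) ℝ) (k : ℕ) :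
    Matrix (Fin n) (Fin n) ℝ :=
  (riccati A B Q R)^[k] 0

theorem riccatiIter_succ (k : ℕ) :
    riccatiIter A B Q R (k + 1) = riccati A B Q R (riccatiIter A B Q R k) :=
  Function.iterate_succ_apply' _ _ _

theorem posSemidef_riccatiIter (hQ : Q.PosSemidef) (hR : R.PosDef) (k : ℕ) :
    (riccatiIter A B Q R k).PosSemidef := by
  induction k with
  | zero => exact PosSemidef.zero
  | succ k ih => rw [riccatiIter_succ]; exact posSemidef_riccati hQ hR ih

theorem monotone_riccatiIter (hQ : Q.PosSemidef) (hR : R.PosDef) (x : Fin n → ℝ) :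
    Monotone fun k => x ⬝ᵥ riccatiIter A B Q R k *ᵥ x := by
  refine monotone_nat_of_le_succ fun k => ?_
  induction k generalizing x with
  | zero =>
    have := quad_nonneg_of_posSemidef (posSemidef_riccatiIter (A := A) (B := B) hQ hR 1) x
    simpa [riccatiIter] using this
  | succ k ih =>
    rw [riccatiIter_succ, riccatiIter_succ (k := k + 1)]
    exact riccati_mono hR (posSemidef_riccatiIter hQ hR _) (posSemidef_riccatiIter hQ hR _) ih x

theorem exists_abs_quad_le (M : Matrix (Fin n) (Fin n) ℝ) :
    ∃ c : ℝ, 0 ≤ c ∧ ∀ x : Fin n → ℝ, x ⬝ᵥ M *ᵥ x ≤ c * ‖x‖ ^ 2 := by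
  refine ⟨∑ i, ∑ j, |M i j|, by positivity, fun x => ?_⟩
  simp only [dotProduct, mulVec, Finset.mul_sum, Finset.sum_mul]
  refine Finset.sum_le_sum fun i _ => Finset.sum_le_sum fun j _ => ?_
  refine (le_abs_self _).trans ?_
  rw [abs_mul, abs_mul]
  have hi : |x i| ≤ ‖x‖ := norm_le_pi_norm x i
  have hj : |x j| ≤ ‖x‖ := norm_le_pi_norm x j
  calc |x i| * (|M i j| * |x j|) = |M i j| * (|x i| * |x j|) := by ring
    _ ≤ |M i j| * (‖x‖ * ‖x‖) := by gcongr
    _ = _ := by ring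

/-- The `k`-th iterate is at most the cost of running a stabilizing feedback `F` for `k` steps, and
that cost is dominated by a convergent geometric series. -/
theorem bddAbove_riccatiIter (hQ : Q.PosSemidef) (hR : R.PosDef) (hAB : Stabilizable A B)
    (x : Fin n → ℝ) : BddAbove (Set.range fun k => x ⬝ᵥ riccatiIter A B Q R k *ᵥ x) := by
  obtain ⟨F, hF⟩ := hAB
  set M := A + B * F with hM
  obtain ⟨C, r, hC, hr, hr1, hdec⟩ := hF.exists_norm_le
  obtain ⟨c, hc, hquad⟩ := exists_abs_quad_le (Q + Fᵀ * R * F)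
  have hsum : ∀ (k : ℕ) (y : Fin n → ℝ), y ⬝ᵥ riccatiIter A B Q R k *ᵥ y
      ≤ ∑ j ∈ Finset.range k, ((M ^ j) *ᵥ y) ⬝ᵥ (Q + Fᵀ * R * F) *ᵥ ((M ^ j) *ᵥ y) := by
    intro k
    induction k with
    | zero => intro y; simp [riccatiIter]
    | succ k ih =>
      intro y
      rw [riccatiIter_succ, Finset.sum_range_succ']
      have h1 := quad_riccati_le (A := A) (B := B) (Q := Q) hR
        (posSemidef_riccatiIter (A := A) (B := B) hQ hR k) y (F *ᵥ y)
      have h3 : A *ᵥ y + B *ᵥ F *ᵥ y = M *ᵥ y := by rw [hM, add_mulVec, mulVec_mulVec]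
      rw [h3] at h1
      have h2 := ih (M *ᵥ y)
      have hpow : ∀ j, (M ^ j) *ᵥ M *ᵥ y = (M ^ (j + 1)) *ᵥ y := fun j => by
        rw [mulVec_mulVec, pow_succ]
      simp only [hpow] at h2
      rw [pow_zero, one_mulVec, add_mulVec, dotProduct_add, quad_congr]
      linarith
  have hr2 : r ^ 2 < 1 := by nlinarith
  have hsummable : Summable fun j : ℕ => c * (C * ‖x‖) ^ 2 * (r ^ 2) ^ j :=
    (summable_geometric_of_lt_one (by positivity) hr2).mul_left _
  refine ⟨∑' j : ℕ, c * (C * ‖x‖) ^ 2 * (r ^ 2) ^ j, ?_⟩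
  rintro _ ⟨k, rfl⟩
  refine (hsum k x).trans (le_trans (Finset.sum_le_sum fun j _ => ?_)
    (hsummable.sum_le_tsum (Finset.range k) fun j _ => by positivity))
  calc _ ≤ c * ‖(M ^ j) *ᵥ x‖ ^ 2 := hquad _
    _ ≤ c * (C * r ^ j * ‖x‖) ^ 2 := by gcongr; exact hdec j x
    _ = _ := by ring

theorem continuousAt_riccati {P : Matrix (Fin n) (Fin n) ℝ} (hR : R.PosDef) (hP : P.PosSemidef) :
    ContinuousAt (riccati A B Q R) P := by
  have hS := (posDef_weight (B := B) hR hP).det_pos.ne'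
  have hc : Continuous fun P : Matrix (Fin n) (Fin n) ℝ => R + Bᵀ * P * B := by fun_prop
  have hinv : ContinuousAt (fun P : Matrix (Fin n) (Fin n) ℝ => (R + Bᵀ * P * B)⁻¹) P := by
    -- The inverse is the adjugate divided by the determinant, which is nonzero at `P`.
    simp only [Matrix.inv_def, Ring.inverse_eq_inv']
    exact (hc.matrix_det.continuousAt.inv₀ hS).smul hc.matrix_adjugate.continuousAt
  have hmul : ∀ {a b c : ℕ} {f : Matrix (Fin n) (Fin n) ℝ → Matrix (Fin a) (Fin b) ℝ}
      {g : Matrix (Fin n) (Fin n) ℝ → Matrix (Fin b) (Fin c) ℝ},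
      ContinuousAt f P → ContinuousAt g P → ContinuousAt (fun P => f P * g P) P := by
    intro a b c f g hf hg
    exact (Continuous.matrix_mul continuous_fst continuous_snd).continuousAt.comp₂ hf hg
  have hid : ContinuousAt (fun P : Matrix (Fin n) (Fin n) ℝ => P) P := continuousAt_id
  have h1 : ContinuousAt (fun P : Matrix (Fin n) (Fin n) ℝ => Aᵀ * P * B) P :=
    Continuous.continuousAt (by fun_prop)
  have h2 : ContinuousAt (fun P : Matrix (Fin n) (Fin n) ℝ => Aᵀ * P * A + Q) P :=
    Continuous.continuousAt (by fun_prop)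
  exact h2.sub (hmul (hmul (hmul (hmul h1 hinv) continuousAt_const) hid) continuousAt_const)

/-- The iterates increase and stay bounded as quadratic forms, hence converge entrywise; by
continuity the limit is a fixed point. -/
theorem exists_riccati_eq (hQ : Q.PosSemidef) (hR : R.PosDef) (hAB : Stabilizable A B) :
    ∃ P : Matrix (Fin n) (Fin n) ℝ, P.PosSemidef ∧ riccati A B Q R P = P := by
  have hq : ∀ x : Fin n → ℝ, ∃ y, Tendsto (fun k => x ⬝ᵥ riccatiIter A B Q R k *ᵥ x) atTop (𝓝 y) :=
    fun x => ⟨_, tendsto_atTop_ciSup (monotone_riccatiIter hQ hR x)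
      (bddAbove_riccatiIter hQ hR hAB x)⟩
  have hentry : ∀ i j, ∃ y, Tendsto (fun k => riccatiIter A B Q R k i j) atTop (𝓝 y) := by
    intro i j
    obtain ⟨y₁, h₁⟩ := hq (Pi.single i 1 + Pi.single j 1)
    obtain ⟨y₂, h₂⟩ := hq (Pi.single i 1)
    obtain ⟨y₃, h₃⟩ := hq (Pi.single j 1)
    refine ⟨(y₁ - y₂ - y₃) / 2, ?_⟩
    simp_rw [fun k => entry_eq_quad (posSemidef_riccatiIter (A := A) (B := B) hQ hR k).1 i j]
    exact ((h₁.sub h₂).sub h₃).div_const 2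
  choose P hP using hentry
  have hlim : Tendsto (fun k => riccatiIter A B Q R k) atTop (𝓝 (Matrix.of P)) :=
    tendsto_pi_nhds.2 fun i => tendsto_pi_nhds.2 fun j => hP i j
  have hPpos : (Matrix.of P).PosSemidef := by
    refine PosSemidef.of_dotProduct_mulVec_nonneg ?_ fun x => ?_
    · ext i j
      refine tendsto_nhds_unique (hP j i) ?_
      have : ∀ k, riccatiIter A B Q R k j i = riccatiIter A B Q R k i j := fun k => by
        simpa using (posSemidef_riccatiIter (A := A) (B := B) hQ hR k).1.apply i j
      simp_rw [this]
      exact hP i j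
    · have hc : Continuous fun P : Matrix (Fin n) (Fin n) ℝ => x ⬝ᵥ P *ᵥ x := by fun_prop
      exact ge_of_tendsto' ((hc.tendsto _).comp hlim) fun k =>
        quad_nonneg_of_posSemidef (posSemidef_riccatiIter (A := A) (B := B) hQ hR k) x
  refine ⟨Matrix.of P, hPpos, ?_⟩
  have h1 := (continuousAt_riccati (A := A) (B := B) (Q := Q) hR hPpos).tendsto.comp hlim
  have h2 := hlim.comp (tendsto_add_atTop_nat 1)
  refine tendsto_nhds_unique h1 (h2.congr fun k => ?_)
  simp [riccatiIter_succ]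

/-- Under stabilizability and detectability the algebraic Riccati equation has exactly one positive
semidefinite solution. -/
theorem existsUnique_riccati {Q₁ : Matrix (Fin n) (Fin n) ℝ} (hQ : Q.PosSemidef) (hR : R.PosDef)
    (hAB : Stabilizable A B) (hQ₁ : Q₁.PosSemidef)
    (hle : ∀ x, x ⬝ᵥ Q₁ *ᵥ x ≤ x ⬝ᵥ Q *ᵥ x) (hdet : Detectable A (CFC.sqrt Q₁)) :
    ∃! P : Matrix (Fin n) (Fin n) ℝ, P.PosSemidef ∧ riccati A B Q R P = P := by
  obtain ⟨P, hP, hric⟩ := exists_riccati_eq hQ hR hAB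
  refine ⟨P, ⟨hP, hric⟩, fun P' ⟨hP', hric'⟩ => eq_of_quad_eq hP'.1 hP.1 fun x => ?_⟩
  exact le_antisymm
    (quad_le_of_schurStable hR hP' hP hric' hric (schurStable_of_riccati hR hP hric hQ₁ hle hdet) x)
    (quad_le_of_schurStable hR hP hP' hric hric'
      (schurStable_of_riccati hR hP' hric' hQ₁ hle hdet) x)

end Riccati


/-! ### The optimal steady state. -/

/-- A positive definite bilinear form on a finite-dimensional space represents every functional. -/
theorem exists_bilin_eq {V : Type*} [AddCommGroup V] [Module ℝ V] [FiniteDimensional ℝ V]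
    (b : V →ₗ[ℝ] V →ₗ[ℝ] ℝ) (hb : ∀ v, b v v ≤ 0 → v = 0) (g : V →ₗ[ℝ] ℝ) : ∃ v, b v = g := by
  have hinj : Function.Injective b := by
    refine (injective_iff_map_eq_zero b).2 fun v hv => hb v ?_
    rw [hv]; simp
  exact (LinearMap.injective_iff_surjective_of_finrank_eq_finrank
    (Subspace.dual_finrank_eq (K := ℝ) (V := V)).symm).1 hinj g

namespace Data

variable {n l m : ℕ} (D : Data n l m)

/-- The bilinear form of the deterministic stage cost. -/
def costBilin : ((Fin n → ℝ) × (Fin l → ℝ)) →ₗ[ℝ] ((Fin n → ℝ) × (Fin l → ℝ)) →ₗ[ℝ] ℝ :=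
  LinearMap.mk₂ ℝ (fun p q => p.1 ⬝ᵥ D.Q₁ *ᵥ q.1 + p.2 ⬝ᵥ D.R₁ *ᵥ q.2)
    (fun p p' q => by simp [add_dotProduct]; ring)
    (fun c p q => by simp [smul_dotProduct]; ring)
    (fun p q q' => by simp [mulVec_add, dotProduct_add]; ring)
    (fun c p q => by simp [mulVec_smul, dotProduct_smul]; ring)

/-- The linear part of the deterministic stage cost. -/
def costLin : ((Fin n → ℝ) × (Fin l → ℝ)) →ₗ[ℝ] ℝ where
  toFun p := D.s ⬝ᵥ p.1 + D.v ⬝ᵥ p.2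
  map_add' p q := by simp [dotProduct_add]; ring
  map_smul' c p := by simp [dotProduct_smul]; ring

/-- The linear map whose fibers are the sets of steady states. -/
def steadyMap : ((Fin n → ℝ) × (Fin l → ℝ)) →ₗ[ℝ] (Fin n → ℝ) where
  toFun p := (1 - D.A) *ᵥ p.1 - D.B *ᵥ p.2
  map_add' p q := by simp only [Prod.fst_add, Prod.snd_add, mulVec_add]; abel
  map_smul' c p := by
    simp only [Prod.smul_fst, Prod.smul_snd, mulVec_smul, RingHom.id_apply, smul_sub]

theorem detCost_add (x y : Fin n → ℝ) (u t : Fin l → ℝ) :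
    D.detCost (x + y) (u + t) = D.detCost x u
      + (2 * (x ⬝ᵥ D.Q₁ *ᵥ y) + 2 * (u ⬝ᵥ D.R₁ *ᵥ t) + D.s ⬝ᵥ y + D.v ⬝ᵥ t)
      + (y ⬝ᵥ D.Q₁ *ᵥ y + t ⬝ᵥ D.R₁ *ᵥ t) := by
  simp only [detCost, quad_add D.posSemidef_Q₁.1, quad_add D.posDef_R₁.1, dotProduct_add]
  ring

/-- Vanishing cost forces zero input and a state in the kernel of `CFC.sqrt D.Q₁`. Such a steady
direction is fixed by `A`, hence by the stable matrix from detectability, so it is zero. -/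
theorem eq_zero_of_costBilin (hdetect : Detectable D.A (CFC.sqrt D.Q₁))
    {p : (Fin n → ℝ) × (Fin l → ℝ)} (hp : D.steadyMap p = 0) (h : D.costBilin p p ≤ 0) : p = 0 := by
  have h' : p.1 ⬝ᵥ D.Q₁ *ᵥ p.1 + p.2 ⬝ᵥ D.R₁ *ᵥ p.2 ≤ 0 := h
  have h1 := quad_nonneg_of_posSemidef D.posSemidef_Q₁ p.1
  have h2 := quad_nonneg_of_posSemidef D.posDef_R₁.posSemidef p.2
  have hu : p.2 = 0 := eq_zero_of_quad_of_posDef D.posDef_R₁ (by linarith)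
  have hc : CFC.sqrt D.Q₁ *ᵥ p.1 = 0 := sqrt_mulVec_eq_zero D.posSemidef_Q₁ (by linarith)
  obtain ⟨L, hL⟩ := hdetect
  have hp' : (1 - D.A) *ᵥ p.1 - D.B *ᵥ p.2 = 0 := hp
  rw [hu, mulVec_zero, sub_zero, sub_mulVec, one_mulVec, sub_eq_zero] at hp'
  have hx : p.1 = 0 := hL.eq_zero_of_mulVec_eq (by
    rw [add_mulVec, ← mulVec_mulVec, hc, mulVec_zero, add_zero, ← hp'])
  exact Prod.ext hx hu

/-- There is exactly one optimal steady state. -/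
theorem existsUnique_isOptimalSteadyState (hdetect : Detectable D.A (CFC.sqrt D.Q₁))
    {w : Fin m → ℝ} (hsteady : ∃ xs us, D.IsSteadyState w xs us) :
    ∃! p : (Fin n → ℝ) × (Fin l → ℝ), D.IsOptimalSteadyState w p.1 p.2 := by
  obtain ⟨x₀, u₀, h₀⟩ := hsteady
  let V := LinearMap.ker D.steadyMap
  -- Moving from `(x₀, u₀)` by `q` makes the derivative of the cost vanish along `V`; the factor
  -- `2⁻¹` offsets the 2 from differentiating the quadratic part.
  obtain ⟨q, hq⟩ := exists_bilin_eq (D.costBilin.domRestrict₁₂ V V)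
    (fun q hq => Subtype.ext (D.eq_zero_of_costBilin hdetect q.2 hq))
    (-((D.costBilin (x₀, u₀) + (2⁻¹ : ℝ) • D.costLin).domRestrict V))
  set p : (Fin n → ℝ) × (Fin l → ℝ) := (x₀, u₀) + q with hp
  have hgrad : ∀ r : V, 2 * D.costBilin p r + D.costLin r = 0 := fun r => by
    have h1 := LinearMap.congr_fun hq r
    simp only [LinearMap.domRestrict₁₂_apply, LinearMap.neg_apply, LinearMap.domRestrict_apply,
      LinearMap.add_apply, LinearMap.smul_apply, smul_eq_mul] at h1
    rw [hp, map_add, LinearMap.add_apply, h1]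
    ring
  have hss : ∀ p' : (Fin n → ℝ) × (Fin l → ℝ), D.IsSteadyState w p'.1 p'.2 ↔
      p' - (x₀, u₀) ∈ V := fun p' => by
    rw [LinearMap.mem_ker, map_sub, sub_eq_zero]
    change D.steadyMap p' = _ ↔ _
    rw [show D.steadyMap (x₀, u₀) = D.E *ᵥ w + D.z from h₀]
  have hps : D.IsSteadyState w p.1 p.2 := (hss p).2 (by rw [hp, add_sub_cancel_left]; exact q.2)
  -- With no first-order term left, the excess cost over `p` is exactly the quadratic form of the
  -- difference. This gives both minimality and uniqueness.
  have hval : ∀ p' : (Fin n → ℝ) × (Fin l → ℝ), D.IsSteadyState w p'.1 p'.2 →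
      D.detCost p'.1 p'.2 = D.detCost p.1 p.2 + D.costBilin (p' - p) (p' - p)
        ∧ D.steadyMap (p' - p) = 0 := by
    intro p' hp'
    have hmem : p' - p ∈ V := by
      have := V.sub_mem ((hss p').1 hp') ((hss p).1 hps)
      simpa using this
    refine ⟨?_, hmem⟩
    have h1 := D.detCost_add p.1 (p' - p).1 p.2 (p' - p).2
    have h2 : 2 * (p.1 ⬝ᵥ D.Q₁ *ᵥ (p' - p).1 + p.2 ⬝ᵥ D.R₁ *ᵥ (p' - p).2)
      + (D.s ⬝ᵥ (p' - p).1 + D.v ⬝ᵥ (p' - p).2) = 0 := hgrad ⟨p' - p, hmem⟩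
    have h3 : D.costBilin (p' - p) (p' - p) = (p' - p).1 ⬝ᵥ D.Q₁ *ᵥ (p' - p).1
      + (p' - p).2 ⬝ᵥ D.R₁ *ᵥ (p' - p).2 := rfl
    have h4 : p.1 + (p' - p).1 = p'.1 := by simp
    have h5 : p.2 + (p' - p).2 = p'.2 := by simp
    rw [h4, h5] at h1
    rw [h1, h3]
    linarith
  refine ⟨p, ⟨hps, fun x' u' h' => ?_⟩, fun p' hp' => ?_⟩
  · have h1 := (hval (x', u') h').1
    have h2 : 0 ≤ D.costBilin ((x', u') - p) ((x', u') - p) :=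
      add_nonneg (quad_nonneg_of_posSemidef D.posSemidef_Q₁ _)
        (quad_nonneg_of_posSemidef D.posDef_R₁.posSemidef _)
    simp only at h1
    linarith
  · obtain ⟨h1, h2⟩ := hval p' hp'.1
    have h3 := hp'.2 p.1 p.2 hps
    exact sub_eq_zero.1 (D.eq_zero_of_costBilin hdetect h2 (by linarith))

end Data


/-! ### Integrals of linear and quadratic expressions in random vectors. -/

section Moments

variable {Ω : Type*} [MeasurableSpace Ω] {μ : Measure Ω} {a b : ℕ}

theorem memLp_mulVec {X : Ω → Fin a → ℝ} (hX : MemLp X 2 μ) (M : Matrix (Fin b) (Fin a) ℝ) :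
    MemLp (fun ω => M *ᵥ X ω) 2 μ :=
  (LinearMap.toContinuousLinearMap M.mulVecLin).comp_memLp' hX

theorem integral_mulVec [IsFiniteMeasure μ] {X : Ω → Fin a → ℝ} (hX : MemLp X 2 μ)
    (M : Matrix (Fin b) (Fin a) ℝ) : ∫ ω, M *ᵥ X ω ∂μ = M *ᵥ ∫ ω, X ω ∂μ :=
  (LinearMap.toContinuousLinearMap M.mulVecLin).integral_comp_comm (hX.integrable (by norm_num))

theorem integrable_dotProduct_mulVec {X : Ω → Fin a → ℝ} {Y : Ω → Fin b → ℝ} (hX : MemLp X 2 μ)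
    (hY : MemLp Y 2 μ) (M : Matrix (Fin a) (Fin b) ℝ) :
    Integrable (fun ω => X ω ⬝ᵥ M *ᵥ Y ω) μ := by
  have hY' := memLp_mulVec hY M
  simp only [dotProduct]
  exact integrable_finsetSum _ fun i _ => (hX.eval i).integrable_mul (hY'.eval i)

theorem integrable_const_dotProduct [IsFiniteMeasure μ] {X : Ω → Fin a → ℝ} (hX : MemLp X 2 μ)
    (c : Fin a → ℝ) : Integrable (fun ω => c ⬝ᵥ X ω) μ := by
  simp only [dotProduct]
  exact integrable_finsetSum _ fun i _ => ((hX.eval i).integrable (by norm_num)).const_mul _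

theorem integral_const_dotProduct [IsFiniteMeasure μ] {X : Ω → Fin a → ℝ} (hX : MemLp X 2 μ)
    (c : Fin a → ℝ) : ∫ ω, c ⬝ᵥ X ω ∂μ = c ⬝ᵥ ∫ ω, X ω ∂μ := by
  have hi : ∀ i, Integrable (fun ω => X ω i) μ := fun i => (hX.eval i).integrable (by norm_num)
  simp only [dotProduct]
  rw [integral_finsetSum _ fun i _ => (hi i).const_mul _]
  simp only [integral_const_mul, eval_integral hi]

theorem integral_sub_mean [IsProbabilityMeasure μ] {X : Ω → Fin a → ℝ} (hX : MemLp X 2 μ) :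
    ∫ ω, (X ω - ∫ ω', X ω' ∂μ) ∂μ = 0 := by
  rw [integral_sub (hX.integrable (by norm_num)) (integrable_const _)]
  simp

theorem integral_dotProduct_eq_zero_of_indepFun [IsProbabilityMeasure μ] {X Y : Ω → Fin a → ℝ}
    (hX : MemLp X 2 μ) (hY : MemLp Y 2 μ) (hXY : IndepFun X Y μ) (hY0 : ∫ ω, Y ω ∂μ = 0)
    (M : Matrix (Fin a) (Fin a) ℝ) : ∫ ω, X ω ⬝ᵥ M *ᵥ Y ω ∂μ = 0 := by
  have hZ := memLp_mulVec hY M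
  have hZ0 : ∫ ω, M *ᵥ Y ω ∂μ = 0 := by rw [integral_mulVec hY, hY0, mulVec_zero]
  have hXZ : IndepFun X (fun ω => M *ᵥ Y ω) μ :=
    hXY.comp (ψ := fun y => M *ᵥ y) measurable_id (by fun_prop)
  have hi : ∀ i, Integrable (fun ω => (M *ᵥ Y ω) i) μ := fun i =>
    (hZ.eval i).integrable (by norm_num)
  simp only [dotProduct]
  have hprod : ∀ i, Integrable (fun ω => X ω i * (M *ᵥ Y ω) i) μ := fun i =>
    (hX.eval i).integrable_mul (hZ.eval i)
  rw [integral_finsetSum _ fun i _ => hprod i]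
  refine Finset.sum_eq_zero fun i _ => ?_
  have h := (hXZ.comp (measurable_pi_apply i) (measurable_pi_apply i)).integral_fun_mul_eq_mul_integral
    (hX.eval i).1 (hZ.eval i).1
  have h0 : ∫ ω, (M *ᵥ Y ω) i ∂μ = 0 := by
    rw [← eval_integral hi, hZ0]; rfl
  simp only [Function.comp_apply, h0, mul_zero] at h
  exact h

theorem trace_mul_covMat [IsProbabilityMeasure μ] {X : Ω → Fin a → ℝ} (hX : MemLp X 2 μ)
    (Q : Matrix (Fin a) (Fin a) ℝ) :
    (Q * covMat μ X).trace
      = ∫ ω, (X ω - ∫ ω', X ω' ∂μ) ⬝ᵥ Q *ᵥ (X ω - ∫ ω', X ω' ∂μ) ∂μ := by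
  have hi : ∀ i, Integrable (fun ω => X ω i) μ := fun i => (hX.eval i).integrable (by norm_num)
  have hY : MemLp (fun ω => X ω - ∫ ω', X ω' ∂μ) 2 μ := hX.sub (memLp_const _)
  have hij : ∀ i j, Integrable (fun ω => (X ω - ∫ ω', X ω' ∂μ) i
      * (Q i j * (X ω - ∫ ω', X ω' ∂μ) j)) μ := fun i j =>
    (hY.eval i).integrable_mul ((hY.eval j).const_mul _)
  simp only [trace, diag_apply, mul_apply, dotProduct, mulVec, Finset.mul_sum, covMat, of_apply,
    covariance]
  rw [integral_finsetSum _ fun i _ => integrable_finsetSum _ fun j _ => hij i j]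
  refine Finset.sum_congr rfl fun i _ => ?_
  rw [integral_finsetSum _ fun j _ => hij i j]
  refine Finset.sum_congr rfl fun j _ => ?_
  rw [← integral_const_mul]
  refine integral_congr_ae (ae_of_all _ fun ω => ?_)
  simp only [Pi.sub_apply, eval_integral hi]
  ring

end Moments

/-! ### Decomposition of the stationary cost. -/

namespace Data

variable {n l m : ℕ} (D : Data n l m) {Ω : Type*} [MeasurableSpace Ω] {μ : Measure Ω}

/-- The stage cost splits into the cost of the means and a quadratic cost of the centered
variables. -/
theorem stageCost_eq [IsProbabilityMeasure μ] {X : Ω → Fin n → ℝ} {U : Ω → Fin l → ℝ}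
    (hX : MemLp X 2 μ) (hU : MemLp U 2 μ) :
    D.stageCost μ X U = D.detCost (∫ ω, X ω ∂μ) (∫ ω, U ω ∂μ)
      + ∫ ω, ((X ω - ∫ ω', X ω' ∂μ) ⬝ᵥ (D.Q₁ + D.Q₂) *ᵥ (X ω - ∫ ω', X ω' ∂μ)
        + (U ω - ∫ ω', U ω' ∂μ) ⬝ᵥ (D.R₁ + D.R₂) *ᵥ (U ω - ∫ ω', U ω' ∂μ)) ∂μ := by
  rw [stageCost, trace_mul_covMat hX, trace_mul_covMat hU]
  have hX0 := integral_sub_mean hX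
  have hU0 := integral_sub_mean hU
  set x := ∫ ω, X ω ∂μ
  set u := ∫ ω, U ω ∂μ
  have hX' : MemLp (fun ω => X ω - x) 2 μ := hX.sub (memLp_const _)
  have hU' : MemLp (fun ω => U ω - u) 2 μ := hU.sub (memLp_const _)
  have hcQ := integrable_dotProduct_mulVec (memLp_const x) hX' D.Q₁
  have hcR := integrable_dotProduct_mulVec (memLp_const u) hU' D.R₁
  have hcs := integrable_const_dotProduct hX' D.s
  have hcv := integrable_const_dotProduct hU' D.v
  have hQ₁ := integrable_dotProduct_mulVec hX' hX' D.Q₁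
  have hQ₂ := integrable_dotProduct_mulVec hX' hX' D.Q₂
  have hR₁ := integrable_dotProduct_mulVec hU' hU' D.R₁
  have hR₂ := integrable_dotProduct_mulVec hU' hU' D.R₂
  -- Expansion around the means: the first-order terms integrate to zero by `i1` to `i4`.
  have hpt : ∀ ω, X ω ⬝ᵥ D.Q₁ *ᵥ X ω + U ω ⬝ᵥ D.R₁ *ᵥ U ω + D.s ⬝ᵥ X ω + D.v ⬝ᵥ U ω + D.c
      = D.detCost x u + (2 * (x ⬝ᵥ D.Q₁ *ᵥ (X ω - x)) + 2 * (u ⬝ᵥ D.R₁ *ᵥ (U ω - u))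
          + D.s ⬝ᵥ (X ω - x) + D.v ⬝ᵥ (U ω - u))
        + ((X ω - x) ⬝ᵥ D.Q₁ *ᵥ (X ω - x) + (U ω - u) ⬝ᵥ D.R₁ *ᵥ (U ω - u)) := fun ω => by
    rw [← detCost_add, add_sub_cancel, add_sub_cancel, detCost]
  have i1 : ∫ ω, x ⬝ᵥ D.Q₁ *ᵥ (X ω - x) ∂μ = 0 := by
    rw [integral_const_dotProduct (memLp_mulVec hX' _), integral_mulVec hX', hX0]; simp
  have i2 : ∫ ω, u ⬝ᵥ D.R₁ *ᵥ (U ω - u) ∂μ = 0 := by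
    rw [integral_const_dotProduct (memLp_mulVec hU' _), integral_mulVec hU', hU0]; simp
  have i3 : ∫ ω, D.s ⬝ᵥ (X ω - x) ∂μ = 0 := by
    rw [integral_const_dotProduct hX', hX0]; simp
  have i4 : ∫ ω, D.v ⬝ᵥ (U ω - u) ∂μ = 0 := by
    rw [integral_const_dotProduct hU', hU0]; simp
  simp_rw [hpt]
  rw [integral_add ((integrable_const _).fun_add
      ((((hcQ.const_mul 2).fun_add (hcR.const_mul 2)).fun_add hcs).fun_add hcv)) (hQ₁.fun_add hR₁),
    integral_add (integrable_const _) ((((hcQ.const_mul 2).fun_add (hcR.const_mul 2)).fun_add hcs).fun_add hcv),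
    integral_add (((hcQ.const_mul 2).fun_add (hcR.const_mul 2)).fun_add hcs) hcv,
    integral_add ((hcQ.const_mul 2).fun_add (hcR.const_mul 2)) hcs,
    integral_add (hcQ.const_mul 2) (hcR.const_mul 2), integral_const_mul, integral_const_mul,
    i1, i2, i3, i4, integral_add hQ₁ hR₁]
  simp only [add_mulVec, dotProduct_add]
  rw [integral_add (hQ₁.fun_add hQ₂) (hR₁.fun_add hR₂), integral_add hQ₁ hQ₂, integral_add hR₁ hR₂]
  simp
  ring

variable {D} {ϱW : Measure (Fin m → ℝ)} {ϱ : Measure (Fin n → ℝ)}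
  {π : (Fin n → ℝ) → (Fin l → ℝ)} {X : Ω → Fin n → ℝ} {V : Ω → Fin m → ℝ}

theorem IsWitness.memLp_input (h : D.IsWitness μ ϱW ϱ π X V) :
    MemLp (fun ω => π (X ω)) 2 μ := h.feedback.2 X h.memLp_state

theorem IsWitness.memLp_next [IsFiniteMeasure μ] (h : D.IsWitness μ ϱW ϱ π X V) :
    MemLp (fun ω => D.f (X ω) (π (X ω)) (V ω)) 2 μ :=
  (((memLp_mulVec h.memLp_state D.A).add (memLp_mulVec h.memLp_input D.B)).add
    (memLp_mulVec h.memLp_noise D.E)).add (memLp_const D.z)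

/-- Stationarity in the form in which it is used: with the identity for the means and with a
quadratic form for the second moments. -/
theorem IsWitness.integral_next (h : D.IsWitness μ ϱW ϱ π X V) [IsFiniteMeasure μ] {F : Type*}
    [NormedAddCommGroup F] [NormedSpace ℝ F] {g : (Fin n → ℝ) → F} (hg : Continuous g) :
    ∫ ω, g (D.f (X ω) (π (X ω)) (V ω)) ∂μ = ∫ ω, g (X ω) ∂μ := by
  rw [← integral_map h.memLp_next.1.aemeasurable hg.aestronglyMeasurable,
    ← integral_map h.memLp_state.1.aemeasurable hg.aestronglyMeasurable, h.law_state, h.law_next]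

theorem IsWitness.integral_noise (h : D.IsWitness μ ϱW ϱ π X V) {F : Type*}
    [NormedAddCommGroup F] [NormedSpace ℝ F] {g : (Fin m → ℝ) → F} (hg : Continuous g) :
    ∫ w, g w ∂ϱW = ∫ ω, g (V ω) ∂μ := by
  rw [← h.law_noise, integral_map h.memLp_noise.1.aemeasurable hg.aestronglyMeasurable]

/-- The means of a feasible pair form a steady state. -/
theorem IsWitness.isSteadyState [IsProbabilityMeasure μ] (h : D.IsWitness μ ϱW ϱ π X V) :
    D.IsSteadyState (∫ w, w ∂ϱW) (∫ ω, X ω ∂μ) (∫ ω, π (X ω) ∂μ) := by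
  have h1 := h.integral_next continuous_id
  have hA := (memLp_mulVec h.memLp_state D.A).integrable (by norm_num)
  have hB := (memLp_mulVec h.memLp_input D.B).integrable (by norm_num)
  have hE := (memLp_mulVec h.memLp_noise D.E).integrable (by norm_num)
  have h2 := h.integral_noise continuous_id
  simp only [id, f] at h1 h2
  rw [integral_add ((hA.fun_add hB).fun_add hE) (integrable_const _),
    integral_add (hA.fun_add hB) hE, integral_add hA hB,
    integral_mulVec h.memLp_state, integral_mulVec h.memLp_input, integral_mulVec h.memLp_noise,
    ← h2] at h1
  simp only [integral_const, probReal_univ, one_smul] at h1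
  rw [IsSteadyState, sub_mulVec, one_mulVec]
  nth_rewrite 1 [← h1]
  abel

theorem gain_eq (P : Matrix (Fin n) (Fin n) ℝ) :
    D.gain P = riccatiGain D.A D.B (D.R₁ + D.R₂) P := rfl

theorem posDef_inputWeight : (D.R₁ + D.R₂).PosDef := D.posDef_R₁.add_posSemidef D.posSemidef_R₂

theorem posSemidef_stateWeight : (D.Q₁ + D.Q₂).PosSemidef := D.posSemidef_Q₁.add D.posSemidef_Q₂

theorem quad_le_stateWeight (x : Fin n → ℝ) : x ⬝ᵥ D.Q₁ *ᵥ x ≤ x ⬝ᵥ (D.Q₁ + D.Q₂) *ᵥ x := by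
  rw [add_mulVec, dotProduct_add]
  exact le_add_of_nonneg_right (quad_nonneg_of_posSemidef D.posSemidef_Q₂ x)

theorem isRiccatiSolution_iff (P : Matrix (Fin n) (Fin n) ℝ) : D.IsRiccatiSolution P ↔
    P.PosSemidef ∧ riccati D.A D.B (D.Q₁ + D.Q₂) (D.R₁ + D.R₂) P = P :=
  and_congr_right fun _ => eq_comm

/-- The cost of a feasible pair: the cost of the means, a cost of the noise, and a penalty for the
deviation of the centered feedback from the optimal gain. -/
theorem IsWitness.stageCost_eq [IsProbabilityMeasure μ] (h : D.IsWitness μ ϱW ϱ π X V)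
    {P : Matrix (Fin n) (Fin n) ℝ} (hP : D.IsRiccatiSolution P) :
    D.stageCost μ X (π ∘ X) = D.detCost (∫ ω, X ω ∂μ) (∫ ω, π (X ω) ∂μ)
      + ∫ w, (D.E *ᵥ (w - ∫ w', w' ∂ϱW)) ⬝ᵥ P *ᵥ (D.E *ᵥ (w - ∫ w', w' ∂ϱW)) ∂ϱW
      + ∫ ω, (π (X ω) - ∫ ω', π (X ω') ∂μ - D.gain P *ᵥ (X ω - ∫ ω', X ω' ∂μ)) ⬝ᵥ
          (D.R₁ + D.R₂ + D.Bᵀ * P * D.B) *ᵥ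
          (π (X ω) - ∫ ω', π (X ω') ∂μ - D.gain P *ᵥ (X ω - ∫ ω', X ω' ∂μ)) ∂μ := by
  obtain ⟨hPpos, hric⟩ := (D.isRiccatiSolution_iff P).1 hP
  have hsteady := h.isSteadyState
  have hmeanV : ∫ w, w ∂ϱW = ∫ ω, V ω ∂μ := h.integral_noise continuous_id
  have hV0 := integral_sub_mean h.memLp_noise
  rw [← hmeanV] at hV0
  rw [Data.stageCost_eq D h.memLp_state (U := π ∘ X) h.memLp_input]
  simp only [Function.comp_apply]
  set x := ∫ ω, X ω ∂μ
  set u := ∫ ω, π (X ω) ∂μ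
  set w₀ := ∫ w, w ∂ϱW
  have hX' : MemLp (fun ω => X ω - x) 2 μ := h.memLp_state.sub (memLp_const _)
  have hU' : MemLp (fun ω => π (X ω) - u) 2 μ := h.memLp_input.sub (memLp_const _)
  have hV' : MemLp (fun ω => V ω - w₀) 2 μ := h.memLp_noise.sub (memLp_const _)
  have hEV := memLp_mulVec hV' D.E
  set Y : Ω → Fin n → ℝ := fun ω => D.A *ᵥ (X ω - x) + D.B *ᵥ (π (X ω) - u) with hYdef
  have hY : MemLp Y 2 μ := (memLp_mulVec hX' D.A).add (memLp_mulVec hU' D.B)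
  have hZ : MemLp (fun ω => π (X ω) - u - D.gain P *ᵥ (X ω - x)) 2 μ :=
    hU'.sub (memLp_mulVec hX' _)
  have hindep : IndepFun Y (fun ω => D.E *ᵥ (V ω - w₀)) μ := by
    have hπ := h.feedback.1
    exact h.indep.comp (φ := fun y => D.A *ᵥ (y - x) + D.B *ᵥ (π y - u))
      (ψ := fun y => D.E *ᵥ (y - w₀)) (by fun_prop) (by fun_prop)
  have hcross : ∫ ω, Y ω ⬝ᵥ P *ᵥ (D.E *ᵥ (V ω - w₀)) ∂μ = 0 :=
    integral_dotProduct_eq_zero_of_indepFun hY hEV hindep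
      (by rw [integral_mulVec hV', hV0, mulVec_zero]) P
  have hnoise : ∫ w, (D.E *ᵥ (w - w₀)) ⬝ᵥ P *ᵥ (D.E *ᵥ (w - w₀)) ∂ϱW
      = ∫ ω, (D.E *ᵥ (V ω - w₀)) ⬝ᵥ P *ᵥ (D.E *ᵥ (V ω - w₀)) ∂μ :=
    h.integral_noise (g := fun w => (D.E *ᵥ (w - w₀)) ⬝ᵥ P *ᵥ (D.E *ᵥ (w - w₀))) (by fun_prop)
  -- Since the means form a steady state, the centered dynamics have no constant term.
  have hnext : ∀ ω, D.f (X ω) (π (X ω)) (V ω) - x = Y ω + D.E *ᵥ (V ω - w₀) := fun ω => by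
    have hs : x = D.A *ᵥ x + D.B *ᵥ u + (D.E *ᵥ w₀ + D.z) := by
      rw [← hsteady, sub_mulVec, one_mulVec]; abel
    rw [f, hYdef]
    nth_rewrite 1 [hs]
    simp only [mulVec_sub]
    abel
  have hinv : ∫ ω, (X ω - x) ⬝ᵥ P *ᵥ (X ω - x) ∂μ = ∫ ω, Y ω ⬝ᵥ P *ᵥ Y ω ∂μ
      + ∫ ω, (D.E *ᵥ (V ω - w₀)) ⬝ᵥ P *ᵥ (D.E *ᵥ (V ω - w₀)) ∂μ := by
    rw [← h.integral_next (g := fun y => (y - x) ⬝ᵥ P *ᵥ (y - x)) (by fun_prop)]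
    simp_rw [hnext, quad_add hPpos.1]
    rw [integral_add ((integrable_dotProduct_mulVec hY hY P).fun_add
        ((integrable_dotProduct_mulVec hY hEV P).const_mul 2))
        (integrable_dotProduct_mulVec hEV hEV P),
      integral_add (integrable_dotProduct_mulVec hY hY P)
        ((integrable_dotProduct_mulVec hY hEV P).const_mul 2), integral_const_mul, hcross]
    ring
  -- Completed square with the Riccati equation inserted. By `hinv` the difference of the two
  -- `P`-terms integrates to the noise term.
  have hpt : ∀ ω, (X ω - x) ⬝ᵥ (D.Q₁ + D.Q₂) *ᵥ (X ω - x)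
        + (π (X ω) - u) ⬝ᵥ (D.R₁ + D.R₂) *ᵥ (π (X ω) - u)
      = (X ω - x) ⬝ᵥ P *ᵥ (X ω - x) - Y ω ⬝ᵥ P *ᵥ Y ω
        + (π (X ω) - u - D.gain P *ᵥ (X ω - x)) ⬝ᵥ (D.R₁ + D.R₂ + D.Bᵀ * P * D.B) *ᵥ
          (π (X ω) - u - D.gain P *ᵥ (X ω - x)) := fun ω => by
    have := riccati_complete_square (A := D.A) (B := D.B) (Q := D.Q₁ + D.Q₂)
      D.posDef_inputWeight hPpos (X ω - x) (π (X ω) - u)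
    rw [hric, ← gain_eq] at this
    linarith
  simp_rw [hpt]
  rw [integral_add ((integrable_dotProduct_mulVec hX' hX' P).sub'
      (integrable_dotProduct_mulVec hY hY P)) (integrable_dotProduct_mulVec hZ hZ _),
    integral_sub (integrable_dotProduct_mulVec hX' hX' P) (integrable_dotProduct_mulVec hY hY P),
    hinv, hnoise]
  ring

end Data


/-! ### Stationary laws of stable affine recursions. -/

section Stationary

variable {n m : ℕ}

/-- The continuous linear map of a matrix. -/
noncomputable def mulVecCLM (M : Matrix (Fin n) (Fin m) ℝ) : (Fin m → ℝ) →L[ℝ] (Fin n → ℝ) :=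
  LinearMap.toContinuousLinearMap M.mulVecLin

@[simp]
theorem mulVecCLM_apply (M : Matrix (Fin n) (Fin m) ℝ) (x : Fin m → ℝ) :
    mulVecCLM M x = M *ᵥ x := rfl

theorem mulVecCLM_comp_pow (M : Matrix (Fin n) (Fin n) ℝ) (L : StrongDual ℝ (Fin n → ℝ)) (k : ℕ) :
    (L.comp (mulVecCLM (M ^ k))).comp (mulVecCLM M) = L.comp (mulVecCLM (M ^ (k + 1))) := by
  ext x
  simp [pow_succ, mulVec_mulVec]

/-- Powers of `M` contract every point to zero, and the integrands have modulus one, so dominated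
convergence applies. -/
theorem tendsto_charFunDual_comp_pow {M : Matrix (Fin n) (Fin n) ℝ} (hM : SchurStable M)
    (ϱ : Measure (Fin n → ℝ)) [IsProbabilityMeasure ϱ] (L : StrongDual ℝ (Fin n → ℝ)) :
    Tendsto (fun k => charFunDual ϱ (L.comp (mulVecCLM (M ^ k)))) atTop (𝓝 1) := by
  have h1 : (1 : ℂ) = ∫ _, (1 : ℂ) ∂ϱ := by simp
  rw [h1]
  simp only [charFunDual_apply]
  refine tendsto_integral_of_dominated_convergence (fun _ => (1 : ℝ)) (fun k => ?_)
    (integrable_const _) (fun k => ?_) ?_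
  · exact Continuous.aestronglyMeasurable (by fun_prop)
  · exact ae_of_all _ fun x => by rw [Complex.norm_exp_ofReal_mul_I]
  · refine ae_of_all _ fun x => ?_
    have hc : Continuous fun y : Fin n → ℝ => Complex.exp (L y * Complex.I) := by fun_prop
    have := (hc.tendsto 0).comp (hM.tendsto_pow_mulVec x)
    simpa [Function.comp_def] using this

theorem norm_charFunDual_le_one (ν : Measure (Fin n → ℝ)) [IsProbabilityMeasure ν]
    (L : StrongDual ℝ (Fin n → ℝ)) : ‖charFunDual ν L‖ ≤ 1 := by
  have := Measure.isProbabilityMeasure_map (μ := ν) L.measurable.aemeasurable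
  rw [charFunDual_eq_charFun_map_one]
  exact norm_charFun_le_one _

/-- The characteristic function of a stationary distribution of a stable linear recursion is
determined by that of the noise. -/
theorem eq_of_charFunDual_eq_comp_mul {M : Matrix (Fin n) (Fin n) ℝ} (hM : SchurStable M)
    {ϱ₁ ϱ₂ : Measure (Fin n → ℝ)} [IsProbabilityMeasure ϱ₁] [IsProbabilityMeasure ϱ₂]
    {g : StrongDual ℝ (Fin n → ℝ) → ℂ} (hg : ∀ L, ‖g L‖ ≤ 1)
    (h₁ : ∀ L, charFunDual ϱ₁ L = charFunDual ϱ₁ (L.comp (mulVecCLM M)) * g L)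
    (h₂ : ∀ L, charFunDual ϱ₂ L = charFunDual ϱ₂ (L.comp (mulVecCLM M)) * g L) : ϱ₁ = ϱ₂ := by
  refine Measure.ext_of_charFunDual (funext fun L => ?_)
  have hstep : ∀ L, ‖charFunDual ϱ₁ L - charFunDual ϱ₂ L‖
      ≤ ‖charFunDual ϱ₁ (L.comp (mulVecCLM M)) - charFunDual ϱ₂ (L.comp (mulVecCLM M))‖ := by
    intro L
    rw [h₁ L, h₂ L, ← sub_mul, norm_mul]
    exact mul_le_of_le_one_right (norm_nonneg _) (hg L)
  -- Iterating the recursion never decreases the gap, while both terms tend to 1.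
  have hk : ∀ k, ‖charFunDual ϱ₁ L - charFunDual ϱ₂ L‖
      ≤ ‖charFunDual ϱ₁ (L.comp (mulVecCLM (M ^ k)))
        - charFunDual ϱ₂ (L.comp (mulVecCLM (M ^ k)))‖ := by
    intro k
    induction k with
    | zero =>
      have : L.comp (mulVecCLM (M ^ 0)) = L := by ext x; simp
      rw [this]
    | succ k ih => rw [← mulVecCLM_comp_pow]; exact ih.trans (hstep _)
  have hlim := ((tendsto_charFunDual_comp_pow hM ϱ₁ L).sub
    (tendsto_charFunDual_comp_pow hM ϱ₂ L)).norm
  rw [sub_self, norm_zero] at hlim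
  exact sub_eq_zero.1 (norm_le_zero_iff.1 (ge_of_tendsto' hlim hk))

variable {Ω : Type*} [MeasurableSpace Ω] {μ : Measure Ω}

/-- A series of functions with summable `L²` seminorms converges almost everywhere, and its sum
is square integrable. -/
theorem memLp_tsum {F : ℕ → Ω → Fin n → ℝ} (hF : ∀ k, MemLp (F k) 2 μ)
    (hsum : ∑' k, eLpNorm (F k) 2 μ ≠ ∞) :
    (∀ᵐ ω ∂μ, Summable fun k => F k ω) ∧ MemLp (fun ω => ∑' k, F k ω) 2 μ := by
  constructor
  · filter_upwards [summable_norm_of_tsum_eLpNorm_ne_top (by norm_num) (fun k => (hF k).1) hsum]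
      with ω hω using hω.of_norm
  · have hs : ∑' k, ‖(hF k).toLp (F k)‖ₑ ≠ ∞ := by simpa only [Lp.enorm_toLp] using hsum
    refine (Lp.memLp (∑' k, (hF k).toLp (F k))).ae_eq ?_
    filter_upwards [Lp.coeFn_tsum hs, ae_all_iff.2 fun k => (hF k).coeFn_toLp] with ω h1 h2
    rw [h1]
    exact tsum_congr h2

/-- The stationary solution of a stable linear recursion, as a function of the noise sequence. -/
noncomputable def noiseSeries (M : Matrix (Fin n) (Fin n) ℝ) (E : Matrix (Fin n) (Fin m) ℝ)
    (c : Fin n → ℝ) (w : ℕ → Fin m → ℝ) : Fin n → ℝ :=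
  ∑' k, (M ^ k) *ᵥ (E *ᵥ w k + c)

theorem measurable_noiseSeries (M : Matrix (Fin n) (Fin n) ℝ) (E : Matrix (Fin n) (Fin m) ℝ)
    (c : Fin n → ℝ) : Measurable (noiseSeries M E c) := by
  refine Measurable.tsum fun k => ?_
  have : Continuous fun w : ℕ → Fin m → ℝ => (M ^ k) *ᵥ (E *ᵥ w k + c) := by fun_prop
  exact this.measurable

/-- The common law gives all noise terms the same `L²` norm, so the seminorms of the summands are
dominated by a geometric series. -/
theorem memLp_noiseSeries [IsProbabilityMeasure μ] {M : Matrix (Fin n) (Fin n) ℝ}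
    (hM : SchurStable M) (E : Matrix (Fin n) (Fin m) ℝ) (c : Fin n → ℝ)
    {ϱW : Measure (Fin m → ℝ)} {W : ℕ → Ω → Fin m → ℝ} (hW : ∀ k, MemLp (W k) 2 μ)
    (hlaw : ∀ k, μ.map (W k) = ϱW) :
    (∀ᵐ ω ∂μ, Summable fun k => (M ^ k) *ᵥ (E *ᵥ W k ω + c)) ∧
      MemLp (fun ω => noiseSeries M E c fun k => W k ω) 2 μ := by
  have hY : ∀ k, MemLp (fun ω => E *ᵥ W k ω + c) 2 μ := fun k =>
    (memLp_mulVec (hW k) E).add (memLp_const c)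
  have hYnorm : ∀ k, eLpNorm (fun ω => E *ᵥ W k ω + c) 2 μ
      = eLpNorm (fun w => E *ᵥ w + c) 2 ϱW := fun k => by
    rw [← hlaw k, eLpNorm_map_measure (Continuous.aestronglyMeasurable (by fun_prop))
      (hW k).1.aemeasurable]
    rfl
  obtain ⟨C, r, hC, hr, hr1, hdec⟩ := hM.exists_norm_le
  refine memLp_tsum (fun k => memLp_mulVec (hY k) _) ?_
  have hle : ∀ k, eLpNorm (fun ω => (M ^ k) *ᵥ (E *ᵥ W k ω + c)) 2 μ
      ≤ ENNReal.ofReal (C * r ^ k) * eLpNorm (fun w => E *ᵥ w + c) 2 ϱW := fun k => by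
    rw [← hYnorm k]
    exact eLpNorm_le_mul_eLpNorm_of_ae_le_mul (ae_of_all _ fun ω => hdec k _) 2
  refine ne_top_of_le_ne_top ?_ (ENNReal.tsum_le_tsum hle)
  rw [ENNReal.tsum_mul_right]
  refine ENNReal.mul_ne_top ?_ (hYnorm 0 ▸ (hY 0).2.ne)
  exact ((summable_geometric_of_lt_one hr.le hr1).mul_left C).tsum_ofReal_ne_top

theorem indepFun_tail [IsProbabilityMeasure μ] {W : ℕ → Ω → Fin m → ℝ}
    (hmeas : ∀ k, Measurable (W k)) (hindep : iIndepFun W μ) :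
    IndepFun (fun ω k => W (k + 1) ω) (W 0) μ := by
  have h := indep_iSup_of_disjoint (fun k => (hmeas k).comap_le) hindep
    (S := {0}ᶜ) (T := {0}) disjoint_compl_left
  rw [IndepFun_iff_Indep]
  refine indep_of_indep_of_le_right (indep_of_indep_of_le_left h ?_) ?_
  · refine Measurable.comap_le ?_
    refine @measurable_pi_lambda _ _ _ (_) _ _ fun k => ?_
    exact Measurable.mono (comap_measurable (W (k + 1)))
      (le_iSup₂_of_le (k + 1) (by simp) le_rfl) le_rfl
  · exact le_iSup₂_of_le 0 (by simp) le_rfl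

/-- A stable linear recursion driven by i.i.d. square integrable noise has a stationary solution. -/
theorem exists_stationary [IsProbabilityMeasure μ] {M : Matrix (Fin n) (Fin n) ℝ}
    (hM : SchurStable M) (E : Matrix (Fin n) (Fin m) ℝ) (c : Fin n → ℝ)
    {ϱW : Measure (Fin m → ℝ)} {W : ℕ → Ω → Fin m → ℝ} (hW : ∀ k, MemLp (W k) 2 μ)
    (hlaw : ∀ k, μ.map (W k) = ϱW) (hindep : iIndepFun W μ) :
    ∃ (X : Ω → Fin n → ℝ) (V : Ω → Fin m → ℝ), MemLp X 2 μ ∧ MemLp V 2 μ ∧ μ.map V = ϱW ∧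
      IndepFun X V μ ∧ μ.map (fun ω => M *ᵥ X ω + E *ᵥ V ω + c) = μ.map X := by
  -- Measurable modifications keep laws and independence, and the generated σ-algebras then lie in
  -- the ambient one.
  wlog hmeas : ∀ k, Measurable (W k) generalizing W
  · have hae : ∀ k, W k =ᵐ[μ] (hW k).1.mk (W k) := fun k => (hW k).1.ae_eq_mk
    exact this (W := fun k => (hW k).1.mk (W k)) (fun k => (hW k).ae_eq (hae k))
      (fun k => by rw [← Measure.map_congr (hae k), hlaw k]) (hindep.congr hae)
      (fun k => (hW k).1.stronglyMeasurable_mk.measurable)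
  have hg := measurable_noiseSeries M E c
  obtain ⟨hs, hX⟩ := memLp_noiseSeries hM E c (fun k => hW (k + 1)) (fun k => hlaw (k + 1))
  obtain ⟨hs0, -⟩ := memLp_noiseSeries hM E c hW hlaw
  -- The state is built from the noise from time 1 on and `W 0` is the fresh noise. One step of the
  -- recursion yields the series of the unshifted sequence, which has the same law because both
  -- sequences have the same product law.
  refine ⟨fun ω => noiseSeries M E c fun k => W (k + 1) ω, W 0, hX, hW 0, hlaw 0,
    (indepFun_tail hmeas hindep).comp hg measurable_id, ?_⟩
  have hnext : (fun ω => M *ᵥ (noiseSeries M E c fun k => W (k + 1) ω) + E *ᵥ W 0 ω + c)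
      =ᵐ[μ] fun ω => noiseSeries M E c fun k => W k ω := by
    filter_upwards [hs, hs0] with ω h1 h0
    have h2 := (mulVecCLM M).map_tsum h1
    simp only [mulVecCLM_apply, mulVec_mulVec, ← pow_succ'] at h2
    rw [noiseSeries, noiseSeries, h0.tsum_eq_zero_add, h2]
    simp only [pow_zero, one_mulVec]
    abel
  rw [Measure.map_congr hnext]
  have e0 := hindep.map_fun_eq_infinitePi_map hmeas
  have e1 := (hindep.precomp (add_left_injective 1)).map_fun_eq_infinitePi_map
    fun k => hmeas (k + 1)
  simp only [hlaw] at e0 e1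
  have m0 : Measurable fun ω k => W k ω := measurable_pi_lambda _ hmeas
  have m1 : Measurable fun ω k => W (k + 1) ω := measurable_pi_lambda _ fun k => hmeas (k + 1)
  have l0 := Measure.map_map (μ := μ) hg m0
  have l1 := Measure.map_map (μ := μ) hg m1
  rw [e0] at l0
  rw [e1] at l1
  exact l0.symm.trans l1

end Stationary

/-! ### The closed loop and optimality of the feedback. -/

namespace Data

variable {n l m : ℕ} {D : Data n l m} {Ω : Type*} [MeasurableSpace Ω] {μ : Measure Ω}
  {ϱW : Measure (Fin m → ℝ)} {ϱ ϱ' : Measure (Fin n → ℝ)} {P : Matrix (Fin n) (Fin n) ℝ}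
  {xs : Fin n → ℝ} {us : Fin l → ℝ} {π : (Fin n → ℝ) → (Fin l → ℝ)} {X : Ω → Fin n → ℝ}
  {V : Ω → Fin m → ℝ}

theorem isFeedback_optFeedback [IsProbabilityMeasure μ] :
    IsFeedback μ (D.optFeedback P xs us) := by
  refine ⟨?_, fun X hX => ?_⟩
  · unfold optFeedback; fun_prop
  · exact (memLp_mulVec (hX.sub (memLp_const xs)) _).add (memLp_const us)

theorem f_optFeedback (x : Fin n → ℝ) (w : Fin m → ℝ) :
    D.f x (D.optFeedback P xs us x) w = (D.A + D.B * D.gain P) *ᵥ x + D.E *ᵥ w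
      + (D.B *ᵥ us - D.B *ᵥ (D.gain P *ᵥ xs) + D.z) := by
  simp only [f, optFeedback, add_mulVec, mulVec_add, mulVec_sub, ← mulVec_mulVec]
  abel

theorem IsRiccatiSolution.schurStable (hP : D.IsRiccatiSolution P)
    (hdetect : Detectable D.A (CFC.sqrt D.Q₁)) : SchurStable (D.A + D.B * D.gain P) :=
  schurStable_of_riccati D.posDef_inputWeight hP.1 ((D.isRiccatiSolution_iff P).1 hP).2
    D.posSemidef_Q₁ D.quad_le_stateWeight hdetect

theorem existsUnique_isRiccatiSolution (hdetect : Detectable D.A (CFC.sqrt D.Q₁)) :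
    ∃! P, D.IsRiccatiSolution P := by
  simp only [isRiccatiSolution_iff]
  exact existsUnique_riccati D.posSemidef_stateWeight D.posDef_inputWeight D.stabilizable
    D.posSemidef_Q₁ D.quad_le_stateWeight hdetect

/-- The next state is a sum of independent functions of `X` and of `V`, so its characteristic
function factors; stationarity identifies it with that of `ϱ`. -/
theorem IsWitness.charFunDual_eq [IsProbabilityMeasure μ]
    (h : D.IsWitness μ ϱW ϱ (D.optFeedback P xs us) X V) (L : StrongDual ℝ (Fin n → ℝ)) :
    charFunDual ϱ L = charFunDual ϱ (L.comp (mulVecCLM (D.A + D.B * D.gain P)))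
      * charFunDual (ϱW.map fun w =>
          D.E *ᵥ w + (D.B *ᵥ us - D.B *ᵥ (D.gain P *ᵥ xs) + D.z)) L := by
  set c := D.B *ᵥ us - D.B *ᵥ (D.gain P *ᵥ xs) + D.z
  set T := mulVecCLM (D.A + D.B * D.gain P)
  have hX := h.memLp_state.1.aemeasurable
  have hV := h.memLp_noise.1.aemeasurable
  have hψ : Measurable fun w : Fin m → ℝ => D.E *ᵥ w + c := by fun_prop
  have hind : IndepFun (fun ω => T (X ω)) (fun ω => D.E *ᵥ V ω + c) μ :=
    h.indep.comp (φ := T) (ψ := fun w => D.E *ᵥ w + c) T.measurable hψ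
  have hadd := hind.charFunDual_map_fun_add_eq_mul (T.measurable.comp_aemeasurable hX)
    (hψ.comp_aemeasurable hV)
  have hnext : (fun ω => T (X ω) + (D.E *ᵥ V ω + c))
      = fun ω => D.f (X ω) (D.optFeedback P xs us (X ω)) (V ω) := by
    funext ω
    rw [f_optFeedback, add_assoc]
    rfl
  simp only [Function.comp_def] at hadd
  rw [hnext, h.law_next] at hadd
  have h1 : μ.map (fun ω => T (X ω)) = ϱ.map T := by
    rw [← h.law_state, AEMeasurable.map_map_of_aemeasurable T.measurable.aemeasurable hX]; rfl
  have h2 : μ.map (fun ω => D.E *ᵥ V ω + c) = ϱW.map fun w => D.E *ᵥ w + c := by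
    rw [← h.law_noise, AEMeasurable.map_map_of_aemeasurable hψ.aemeasurable hV]; rfl
  rw [h1, h2] at hadd
  rw [congrFun hadd L, Pi.mul_apply, charFunDual_map]

/-- The stationary distribution under the optimal feedback is unique. -/
theorem IsFeasible.eq [IsProbabilityMeasure μ] (hst : SchurStable (D.A + D.B * D.gain P))
    (h : D.IsFeasible μ ϱW ϱ (D.optFeedback P xs us))
    (h' : D.IsFeasible μ ϱW ϱ' (D.optFeedback P xs us)) : ϱ = ϱ' := by
  obtain ⟨X, V, h⟩ := h
  obtain ⟨X', V', h'⟩ := h'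
  have : IsProbabilityMeasure ϱ :=
    h.law_state ▸ Measure.isProbabilityMeasure_map h.memLp_state.1.aemeasurable
  have : IsProbabilityMeasure ϱ' :=
    h'.law_state ▸ Measure.isProbabilityMeasure_map h'.memLp_state.1.aemeasurable
  have : IsProbabilityMeasure ϱW :=
    h.law_noise ▸ Measure.isProbabilityMeasure_map h.memLp_noise.1.aemeasurable
  have hmeas : Measurable fun w : Fin m → ℝ =>
    D.E *ᵥ w + (D.B *ᵥ us - D.B *ᵥ (D.gain P *ᵥ xs) + D.z) := by fun_prop
  have := Measure.isProbabilityMeasure_map (μ := ϱW) hmeas.aemeasurable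
  exact eq_of_charFunDual_eq_comp_mul hst (fun L => norm_charFunDual_le_one _ L)
    h.charFunDual_eq h'.charFunDual_eq

theorem exists_isFeasible_optFeedback [IsProbabilityMeasure μ]
    (hst : SchurStable (D.A + D.B * D.gain P)) (xs : Fin n → ℝ) (us : Fin l → ℝ)
    {W : ℕ → Ω → Fin m → ℝ} (hW : ∀ k, MemLp (W k) 2 μ)
    (hlaw : ∀ k, μ.map (W k) = ϱW) (hindep : iIndepFun W μ) :
    ∃ ϱ, D.IsFeasible μ ϱW ϱ (D.optFeedback P xs us) := by
  obtain ⟨X, V, hX, hV, hVlaw, hXV, hnext⟩ := exists_stationary hst D.E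
    (D.B *ᵥ us - D.B *ᵥ (D.gain P *ᵥ xs) + D.z) hW hlaw hindep
  refine ⟨μ.map X, X, V, isFeedback_optFeedback, hX, hV, rfl, hVlaw, hXV, ?_⟩
  simpa only [f_optFeedback] using hnext

theorem IsFeasible.memP2 [IsProbabilityMeasure μ] (h : D.IsFeasible μ ϱW ϱ π) : MemP2 ϱ := by
  obtain ⟨X, V, h⟩ := h
  have hX := h.memLp_state.1.aemeasurable
  refine ⟨h.law_state ▸ Measure.isProbabilityMeasure_map hX, ?_⟩
  rw [← h.law_state, lintegral_map' (by fun_prop) hX]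
  have := lintegral_rpow_enorm_lt_top_of_eLpNorm_lt_top (by norm_num) (by norm_num)
    h.memLp_state.2
  simpa using this

/-- The part of the optimal cost that is caused by the noise. -/
noncomputable def noiseCost (D : Data n l m) (ϱW : Measure (Fin m → ℝ))
    (P : Matrix (Fin n) (Fin n) ℝ) : ℝ :=
  ∫ w, (D.E *ᵥ (w - ∫ w', w' ∂ϱW)) ⬝ᵥ P *ᵥ (D.E *ᵥ (w - ∫ w', w' ∂ϱW)) ∂ϱW

/-- The penalty for deviating from the optimal gain. -/
noncomputable def gainPenalty (D : Data n l m) (μ : Measure Ω) (P : Matrix (Fin n) (Fin n) ℝ)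
    (X : Ω → Fin n → ℝ) (π : (Fin n → ℝ) → (Fin l → ℝ)) : ℝ :=
  ∫ ω, (π (X ω) - ∫ ω', π (X ω') ∂μ - D.gain P *ᵥ (X ω - ∫ ω', X ω' ∂μ)) ⬝ᵥ
    (D.R₁ + D.R₂ + D.Bᵀ * P * D.B) *ᵥ
    (π (X ω) - ∫ ω', π (X ω') ∂μ - D.gain P *ᵥ (X ω - ∫ ω', X ω' ∂μ)) ∂μ

theorem gainPenalty_nonneg (hP : P.PosSemidef) (X : Ω → Fin n → ℝ)
    (π : (Fin n → ℝ) → (Fin l → ℝ)) : 0 ≤ D.gainPenalty μ P X π :=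
  integral_nonneg fun _ =>
    quad_nonneg_of_posSemidef (posDef_weight D.posDef_inputWeight hP).posSemidef _

theorem IsWitness.ae_eq_of_gainPenalty [IsProbabilityMeasure μ] (h : D.IsWitness μ ϱW ϱ π X V)
    (hP : P.PosSemidef) (h0 : D.gainPenalty μ P X π ≤ 0) :
    ∀ᵐ ω ∂μ, π (X ω) = D.optFeedback P (∫ ω', X ω' ∂μ) (∫ ω', π (X ω') ∂μ) (X ω) := by
  have hS := posDef_weight (B := D.B) D.posDef_inputWeight hP
  have hZ : MemLp (fun ω => π (X ω) - ∫ ω', π (X ω') ∂μ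
      - D.gain P *ᵥ (X ω - ∫ ω', X ω' ∂μ)) 2 μ :=
    (h.memLp_input.sub (memLp_const _)).sub
      (memLp_mulVec (h.memLp_state.sub (memLp_const _)) _)
  have hae := (integral_eq_zero_iff_of_nonneg (fun _ => quad_nonneg_of_posSemidef hS.posSemidef _)
    (integrable_dotProduct_mulVec hZ hZ _)).1 (le_antisymm h0 (gainPenalty_nonneg hP X π))
  filter_upwards [hae] with ω hω
  have := eq_zero_of_quad_of_posDef hS hω.le
  rw [optFeedback, ← sub_eq_zero, ← this]
  abel

theorem IsWitness.stageCost_eq_noiseCost [IsProbabilityMeasure μ]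
    (h : D.IsWitness μ ϱW ϱ π X V) (hP : D.IsRiccatiSolution P) :
    D.stageCost μ X (π ∘ X) = D.detCost (∫ ω, X ω ∂μ) (∫ ω, π (X ω) ∂μ) + D.noiseCost ϱW P
      + D.gainPenalty μ P X π :=
  h.stageCost_eq hP

theorem integral_optFeedback [IsProbabilityMeasure μ] (hX : MemLp X 2 μ) :
    ∫ ω, D.optFeedback P xs us (X ω) ∂μ = D.gain P *ᵥ (∫ ω, X ω ∂μ - xs) + us := by
  have hX' : MemLp (fun ω => X ω - xs) 2 μ := hX.sub (memLp_const _)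
  simp only [optFeedback]
  rw [integral_add ((memLp_mulVec hX' _).integrable (by norm_num)) (integrable_const _),
    integral_mulVec hX', integral_sub (hX.integrable (by norm_num)) (integrable_const _)]
  simp

/-- The cost under the optimal feedback. -/
theorem IsWitness.stageCost_optFeedback [IsProbabilityMeasure μ]
    (h : D.IsWitness μ ϱW ϱ (D.optFeedback P xs us) X V) (hP : D.IsRiccatiSolution P)
    (hst : SchurStable (D.A + D.B * D.gain P)) (hss : D.IsSteadyState (∫ w, w ∂ϱW) xs us) :
    D.stageCost μ X (D.optFeedback P xs us ∘ X) = D.detCost xs us + D.noiseCost ϱW P := by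
  have hmean := integral_optFeedback (D := D) (P := P) (xs := xs) (us := us) h.memLp_state
  have hs := h.isSteadyState
  -- Subtracting the two steady-state equations shows that the difference of the states is fixed by
  -- the stable closed-loop matrix.
  have hx : ∫ ω, X ω ∂μ = xs := by
    refine sub_eq_zero.1 (hst.eq_zero_of_mulVec_eq ?_)
    rw [IsSteadyState] at hs hss
    rw [← hss, hmean] at hs
    simp only [add_mulVec, mulVec_add, mulVec_sub, sub_mulVec, one_mulVec, ← mulVec_mulVec] at hs ⊢
    rw [← sub_eq_zero] at hs ⊢
    rw [← neg_eq_zero, ← hs]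
    abel
  have hu : ∫ ω, D.optFeedback P xs us (X ω) ∂μ = us := by rw [hmean, hx]; simp
  have hpen : D.gainPenalty μ P X (D.optFeedback P xs us) = 0 := by
    rw [gainPenalty, hx, hu]
    simp [optFeedback]
  rw [h.stageCost_eq_noiseCost hP, hpen, hx, hu, add_zero]

theorem IsWitness.le_stageCost [IsProbabilityMeasure μ] (h : D.IsWitness μ ϱW ϱ π X V)
    (hP : D.IsRiccatiSolution P) (hopt : D.IsOptimalSteadyState (∫ w, w ∂ϱW) xs us) :
    D.detCost xs us + D.noiseCost ϱW P ≤ D.stageCost μ X (π ∘ X) := by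
  rw [h.stageCost_eq_noiseCost hP]
  have h1 := hopt.2 _ _ h.isSteadyState
  have h2 := gainPenalty_nonneg (D := D) (μ := μ) hP.1 X π
  linarith

/-- A feasible pair of minimal cost is feasible with the optimal feedback. -/
theorem IsWitness.optFeedback_of_stageCost_le [IsProbabilityMeasure μ]
    (h : D.IsWitness μ ϱW ϱ π X V) (hP : D.IsRiccatiSolution P)
    (huniq : ∃! p : (Fin n → ℝ) × (Fin l → ℝ), D.IsOptimalSteadyState (∫ w, w ∂ϱW) p.1 p.2)
    (hopt : D.IsOptimalSteadyState (∫ w, w ∂ϱW) xs us)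
    (hle : D.stageCost μ X (π ∘ X) ≤ D.detCost xs us + D.noiseCost ϱW P) :
    D.IsWitness μ ϱW ϱ (D.optFeedback P xs us) X V := by
  rw [h.stageCost_eq_noiseCost hP] at hle
  have h1 := hopt.2 _ _ h.isSteadyState
  have h2 := gainPenalty_nonneg (D := D) (μ := μ) hP.1 X π
  -- The cost bound leaves no room: the nonnegative penalty and the excess cost of the means must
  -- both vanish.
  have hopt' : D.IsOptimalSteadyState (∫ w, w ∂ϱW) (∫ ω, X ω ∂μ) (∫ ω, π (X ω) ∂μ) :=
    ⟨h.isSteadyState, fun x' u' h' => by have := hopt.2 x' u' h'; linarith⟩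
  have heq := huniq.unique (y₁ := (∫ ω, X ω ∂μ, ∫ ω, π (X ω) ∂μ)) (y₂ := (xs, us)) hopt' hopt
  have hae := h.ae_eq_of_gainPenalty hP.1 (by linarith)
  rw [(Prod.mk.inj heq).1, (Prod.mk.inj heq).2] at hae
  refine ⟨isFeedback_optFeedback, h.memLp_state, h.memLp_noise, h.law_state, h.law_noise, h.indep,
    ?_⟩
  rw [← h.law_next]
  refine Measure.map_congr ?_
  filter_upwards [hae] with ω hω
  rw [hω]

end Data

end StochLQ

theorem mainTheorem6 {n l m : ℕ} (D : StochLQ.Data n l m)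
    {Ω : Type*} [MeasurableSpace Ω] (μ : Measure Ω) [IsProbabilityMeasure μ]
    (ϱW : Measure (Fin m → ℝ)) (W : ℕ → Ω → Fin m → ℝ)
    (hW_memLp : ∀ k, MemLp (W k) 2 μ)
    (hW_law : ∀ k, μ.map (W k) = ϱW)
    (hW_indep : iIndepFun W μ)
    (hsteady : ∃ xs us, D.IsSteadyState (∫ w, w ∂ϱW) xs us)
    (hdetect : StochLQ.Detectable D.A (CFC.sqrt D.Q₁)) :
    (∃! P, D.IsRiccatiSolution P) ∧
    (∃! p : (Fin n → ℝ) × (Fin l → ℝ), D.IsOptimalSteadyState (∫ w, w ∂ϱW) p.1 p.2) ∧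
    ∀ P, D.IsRiccatiSolution P →
    ∀ xs us, D.IsOptimalSteadyState (∫ w, w ∂ϱW) xs us →
      ∃ ϱs : Measure (Fin n → ℝ), StochLQ.MemP2 ϱs ∧
        (∀ ϱ, D.IsFeasible μ ϱW ϱ (D.optFeedback P xs us) ↔ ϱ = ϱs) ∧
        D.IsSolution μ ϱW ϱs (D.optFeedback P xs us) ∧
        ∀ ϱ' π', D.IsSolution μ ϱW ϱ' π' → ϱ' = ϱs := by
  have huniq := D.existsUnique_isOptimalSteadyState hdetect hsteady
  refine ⟨StochLQ.Data.existsUnique_isRiccatiSolution hdetect, huniq, fun P hP xs us hopt => ?_⟩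
  have hst := hP.schurStable hdetect
  obtain ⟨ϱs, hfeas⟩ :=
    StochLQ.Data.exists_isFeasible_optFeedback hst xs us hW_memLp hW_law hW_indep
  refine ⟨ϱs, hfeas.memP2, fun ϱ => ⟨fun h => h.eq hst hfeas, fun h => h ▸ hfeas⟩,
    ⟨hfeas, fun X V h ϱ' π' X' V' h' => ?_⟩, fun ϱ' π' ⟨⟨X', V', h'⟩, hmin⟩ => ?_⟩
  · rw [h.stageCost_optFeedback hP hst hopt.1]
    exact h'.le_stageCost hP hopt
  · obtain ⟨X, V, h⟩ := id hfeas
    -- Minimality is tested against the optimal feedback, whose cost is the lower bound.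
    have hle := hmin X' V' h' ϱs _ X V h
    rw [h.stageCost_optFeedback hP hst hopt.1] at hle
    exact StochLQ.Data.IsFeasible.eq hst
      ⟨X', V', h'.optFeedback_of_stageCost_le hP huniq hopt hle⟩ hfeas
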